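/- Let $\Gamma_1=\{y\in\mathbb R^n: y_1>0,\dots,y_n>0\}$ and $T_{\Gamma_1}=\{x+iy: x\in\mathbb R^n,\ y\in\Gamma_1\}\subset\mathbb C^n$. Let $H^2(T_{\Gamma_1})$ be the space of holomorphic functions $F$ on $T_{\Gamma_1}$ with $\|F\|^2=\sup_{y\in\Gamma_1}\int_{\mathbb R^n}|F(x+iy)|^2\,dx<\infty$, with inner product $\langle F,G\rangle=\int_{\mathbb R^n}F(\xi)\overline{G(\xi)}\,d\xi$, where $F(\xi)$ denotes the limit of $F(\xi+i\eta)$ in the $L^2(\mathbb R^n)$-norm as $\eta\to0$, $\eta\in\Gamma_1$, and likewise $G(\xi)$. For $w,z\in T_{\Gamma_1}$ let $K(w,\overline z)=\prod_{k=1}^n\frac{-1}{2\pi i(w_k-\overline z_k)}$, and for $\alpha\in\mathbb N_0^n$, $|\alpha|=\sum_j\alpha_j$, $z=x+iy$, let $$\phi_{\alpha,z}(w)=\frac{\partial^{|\alpha|}K(w,\overline z)}{\partial x_1^{\alpha_1}\cdots\partial x_n^{\alpha_n}}.$$ Let $F\in H^2(T_{\Gamma_1})$. Then the $L^2$ limit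 function of $F$ exists, every $\phi_{\alpha,z}$ is a nonzero element of $H^2(T_{\Gamma_1})$, and $$\lim_{|\alpha|\to\infty}\frac{|\langle F,\phi_{\alpha,z}\rangle|}{\|\phi_{\alpha,z}\|}=0\quad\text{uniformly in } z\in T_{\Gamma_1},$$ that is, for every $\varepsilon>0$ there is $N$ such that the quotient is less than $\varepsilon$ for all $\alpha$ with $|\alpha|\ge N$ and all $z\in T_{\Gamma_1}$. Moreover, with the dictionary $\mathcal D=\{\phi_{\alpha,z}/\|\phi_{\alpha,z}\|:\alpha\in\mathbb N_0^n,\ z\in T_{\Gamma_1}\}$, the supremum $\sup_{\psi\in\mathcal D}|\langle F,\psi\rangle|$ is attained by some $\psi\in\mathcal D$. -/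

import Mathlib

open MeasureTheory Filter Topology

noncomputable section

namespace TubeHardy

/-- The first octant `Γ₁ = {y ∈ ℝⁿ : y₁ > 0, …, yₙ > 0}`. -/
def octant (n : ℕ) : Set (Fin n → ℝ) := {y | ∀ j, 0 < y j}

/-- The tube `T_{Γ₁} = {x + iy : x ∈ ℝⁿ, y ∈ Γ₁} ⊆ ℂⁿ` over the first octant. -/
def tube (n : ℕ) : Set (Fin n → ℂ) := {z | ∀ j, 0 < (z j).im}

/-- The point `x + iy ∈ ℂⁿ`. -/
def toC {n : ℕ} (x y : Fin n → ℝ) : Fin n → ℂ := fun j => (x j : ℂ) + Complex.I * (y j : ℂ)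

/-- `sup_{y ∈ Γ₁} ∫_{ℝⁿ} |F(x + iy)|² dx`, as an extended nonnegative real. -/
def hardySq {n : ℕ} (F : (Fin n → ℂ) → ℂ) : ENNReal :=
  ⨆ y ∈ octant n, ∫⁻ x : Fin n → ℝ, ‖F (toC x y)‖ₑ ^ 2

/-- `F ∈ H²(T_{Γ₁})`. A function on the tube is represented by a total function on `ℂⁿ`; only its
values on the tube are ever used. -/
structure MemHardy {n : ℕ} (F : (Fin n → ℂ) → ℂ) : Prop where
  holomorphic : DifferentiableOn ℂ F (tube n)
  bounded : hardySq F < ⊤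

/-- The norm `‖F‖ = (sup_{y ∈ Γ₁} ∫_{ℝⁿ} |F(x + iy)|² dx)^{1/2}` of `H²(T_{Γ₁})`. -/
def hardyNorm {n : ℕ} (F : (Fin n → ℂ) → ℂ) : ℝ := Real.sqrt (hardySq F).toReal

/-- `f ∈ L²(ℝⁿ)` is the limit of `F(· + iη)` in the `L²`-norm as `η → 0`, `η ∈ Γ₁`. -/
structure IsBoundaryValue {n : ℕ} (F : (Fin n → ℂ) → ℂ) (f : (Fin n → ℝ) → ℂ) : Prop where
  memLp : MemLp f 2 volume
  tendsto : Tendsto (fun η : Fin n → ℝ => eLpNorm (fun x => F (toC x η) - f x) 2 volume)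
    (𝓝[octant n] 0) (𝓝 0)

open Classical in
/-- The `L²` boundary function `F(ξ)`, `ξ ∈ ℝⁿ` (unique up to null sets). -/
def boundaryValue {n : ℕ} (F : (Fin n → ℂ) → ℂ) : (Fin n → ℝ) → ℂ :=
  if h : ∃ f, IsBoundaryValue F f then h.choose else 0

/-- The inner product `⟨F, G⟩ = ∫_{ℝⁿ} F(ξ) conj(G(ξ)) dξ` of the boundary functions. -/
def hardyInner {n : ℕ} (F G : (Fin n → ℂ) → ℂ) : ℂ :=
  ∫ ξ : Fin n → ℝ, boundaryValue F ξ * starRingEnd ℂ (boundaryValue G ξ)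

/-- The Cauchy–Szegő kernel; `szego w z` is `K(w, conj z) = ∏ₖ -1 / (2πi (wₖ - conj zₖ))`. -/
def szego {n : ℕ} (w z : Fin n → ℂ) : ℂ :=
  ∏ k, -1 / (2 * (Real.pi : ℂ) * Complex.I * (w k - starRingEnd ℂ (z k)))

/-- The partial derivative `∂g/∂xⱼ` with respect to the real part of the `j`-th coordinate. -/
def partialX {n : ℕ} (j : Fin n) (g : (Fin n → ℂ) → ℂ) (z : Fin n → ℂ) : ℂ :=
  deriv (fun t : ℝ => g (z + Pi.single j (t : ℂ))) 0

/-- `∂^{|α|} g / ∂x₁^{α₁} ⋯ ∂xₙ^{αₙ}`. -/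
def iterPartialX {n : ℕ} (α : Fin n → ℕ) (g : (Fin n → ℂ) → ℂ) : (Fin n → ℂ) → ℂ :=
  (List.finRange n).foldr (fun j h => (partialX j)^[α j] h) g

/-- `φ_{α,z}(w) = ∂^{|α|} K(w, conj z) / ∂x₁^{α₁} ⋯ ∂xₙ^{αₙ}`, where `z = x + iy`. -/
def phi {n : ℕ} (α : Fin n → ℕ) (z : Fin n → ℂ) (w : Fin n → ℂ) : ℂ :=
  iterPartialX α (szego w) z

/-- The normalised kernel derivative `ψ_{α,z} = φ_{α,z} / ‖φ_{α,z}‖`. -/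
def psi {n : ℕ} (α : Fin n → ℕ) (z : Fin n → ℂ) (w : Fin n → ℂ) : ℂ :=
  phi α z w / (hardyNorm (phi α z) : ℂ)

/-- The dictionary `{ψ_{α,z} : α ∈ ℕⁿ, z ∈ T_{Γ₁}}`. -/
def dictionary (n : ℕ) : Set ((Fin n → ℂ) → ℂ) :=
  {g | ∃ α : Fin n → ℕ, ∃ z ∈ tube n, g = psi α z}

/-- The closed form of the `α`-th derivative of the kernel. -/
def phiClosed {n : ℕ} (α : Fin n → ℕ) (z w : Fin n → ℂ) : ℂ :=
  ∏ j, -1 / (2 * (Real.pi : ℂ) * Complex.I) *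
    ((α j).factorial / (w j - starRingEnd ℂ (z j)) ^ (α j + 1))

theorem partialX_closed {n : ℕ} (j : Fin n) (β : Fin n → ℕ) (w : Fin n → ℂ) (hw : w ∈ tube n)
    (g : (Fin n → ℂ) → ℂ) (hg : ∀ z ∈ tube n, g z = phiClosed β z w) (z : Fin n → ℂ)
    (hz : z ∈ tube n) :
    partialX j g z = phiClosed (Function.update β j (β j + 1)) z w := by
  have hmem : ∀ t : ℝ, z + Pi.single j (t : ℂ) ∈ tube n := by
    intro t k
    by_cases h : k = j
    · subst h; simpa using hz k
    · simpa [h] using hz k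
  have hne : w j - starRingEnd ℂ (z j) ≠ 0 := by
    intro h
    have h1 := congrArg Complex.im h
    simp at h1
    have := hw j
    have := hz j
    linarith
  set c : ℂ := -1 / (2 * (Real.pi : ℂ) * Complex.I) with hc
  set P : ℂ := ∏ k ∈ Finset.univ.erase j,
    c * ((β k).factorial / (w k - starRingEnd ℂ (z k)) ^ (β k + 1)) with hP
  have hfun : (fun t : ℝ => g (z + Pi.single j (t : ℂ))) = fun t : ℝ =>
      c * ((β j).factorial * ((w j - starRingEnd ℂ (z j) - (t : ℂ)) ^ (β j + 1))⁻¹) * P := by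
    funext t
    rw [hg _ (hmem t), phiClosed, ← Finset.mul_prod_erase _ _ (Finset.mem_univ j), hP]
    congr 1
    · simp [div_eq_mul_inv, hc, sub_sub]
    · refine Finset.prod_congr rfl fun k hk => ?_
      have : k ≠ j := (Finset.mem_erase.1 hk).1
      simp [this, hc]
  have h0 : HasDerivAt (fun t : ℝ => w j - starRingEnd ℂ (z j) - (t : ℂ)) (-1) 0 := by
    simpa using (Complex.ofRealCLM.hasDerivAt (x := (0 : ℝ))).const_sub
      (w j - starRingEnd ℂ (z j))
  have h1 := (((h0.pow (β j + 1)).inv (by simpa using hne)).const_mul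
    ((β j).factorial : ℂ)).const_mul c |>.mul_const P
  rw [partialX, hfun]
  refine h1.deriv.trans ?_
  rw [phiClosed, ← Finset.mul_prod_erase _ _ (Finset.mem_univ j)]
  congr 1
  · simp only [Function.update_self, Nat.factorial_succ, ← hc]
    push_cast
    simp only [Pi.pow_apply, Complex.ofReal_zero, sub_zero]
    field_simp
    ring
  · refine Finset.prod_congr rfl fun k hk => ?_
    have : k ≠ j := (Finset.mem_erase.1 hk).1
    simp [this, hc]

theorem partialX_iter_closed {n : ℕ} (j : Fin n) (m : ℕ) (β : Fin n → ℕ) (w : Fin n → ℂ)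
    (hw : w ∈ tube n) (g : (Fin n → ℂ) → ℂ) (hg : ∀ z ∈ tube n, g z = phiClosed β z w)
    (z : Fin n → ℂ) (hz : z ∈ tube n) :
    (partialX j)^[m] g z = phiClosed (Function.update β j (β j + m)) z w := by
  induction m generalizing z with
  | zero => simpa using hg z hz
  | succ m ih =>
    rw [Function.iterate_succ_apply', partialX_closed j _ w hw _ ih z hz]
    simp [add_assoc]

/-- The closed form `φ_{α,z}(w) = (-1/2πi)ⁿ ∏ⱼ αⱼ! / (wⱼ - conj zⱼ)^{αⱼ+1}`. -/
theorem phi_eq {n : ℕ} (α : Fin n → ℕ) (z w : Fin n → ℂ) (hz : z ∈ tube n) (hw : w ∈ tube n) :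
    phi α z w = phiClosed α z w := by
  have key : ∀ l : List (Fin n), l.Nodup → ∀ z ∈ tube n,
      l.foldr (fun j h => (partialX j)^[α j] h) (szego w) z =
        phiClosed (fun k => if k ∈ l then α k else 0) z w := by
    intro l
    induction l with
    | nil =>
      intro _ z _
      simp only [List.foldr_nil, szego, phiClosed]
      refine Finset.prod_congr rfl fun k _ => ?_
      simp [div_eq_mul_inv]
      ring
    | cons j l ih =>
      intro hl z hz
      rw [List.nodup_cons] at hl
      rw [List.foldr_cons, partialX_iter_closed j _ _ w hw _ (ih hl.2) z hz]
      congr 1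
      funext k
      by_cases h : k = j
      · subst h; simp [hl.1]
      · simp [h]
  have := key _ (List.nodup_finRange n) z hz
  simpa [phi, iterPartialX] using this

end TubeHardy

end

/-! Index the dictionary by the locally compact space (ℕ × ℍ)ⁿ and regard p ↦ ⟨F, ψ_p⟩ as a function
on it. Everything about the dictionary follows once this function is continuous and vanishes at
infinity. Indeed |α| is bounded on compact sets, which gives decay uniform in z, and a continuous
function vanishing at infinity attains the maximum of its modulus.

By Cauchy–Schwarz, the coefficient map is a contraction from L²(ℝⁿ) into the bounded functions, so
the f whose coefficients have this property form a closed subspace (`isClosed_vanishingSubmodule`).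
It contains each Szegő kernel: the coefficients factor over the coordinates, and in one variable the
squared modulus is B_a⁻¹ y^(2a+1) / |w - conj z|^(2a+2), where y = Im z and B_a = ∫ (1+x²)^(-a-1) dx
≥ √(π/(a+1)). Elementary bounds make this small when a is large, z is far away or y is near 0
(`tendsto_normalizedFactor`). It also contains everything orthogonal to all Szegő kernels, since
orthogonality survives differentiation in z and the coefficients are then zero
(`integral_kernel_eq_zero`). Hence it is all of L² (`mem_vanishingSubmodule`), and no reproducing
formula for F itself is needed.

The boundary function comes from Cauchy's theorem: the pairing of two slices of F depends only on
the sum of their heights (`integral_conj_mul_shift`). So the inner product of two slices is the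
squared norm of the slice midway, and convexity and boundedness of these squared norms make the
slices Cauchy as y → 0 (`cauchy_sliceLp`). -/

namespace TubeHardy

/-! ### Slices of a Hardy function and their pairings -/

variable {n : ℕ}

theorem toC_mem_tube (x : Fin n → ℝ) {y : Fin n → ℝ} (hy : y ∈ octant n) : toC x y ∈ tube n := by
  intro j
  simpa [toC] using hy j

theorem continuous_toC : Continuous fun p : (Fin n → ℝ) × (Fin n → ℝ) => toC p.1 p.2 := by
  unfold toC
  fun_prop

theorem convex_octant : Convex ℝ (octant n) := by
  have : octant n = Set.univ.pi fun _ => Set.Ioi (0 : ℝ) := by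
    ext y; simp [octant]
  rw [this]
  exact convex_pi fun _ _ => convex_Ioi 0

theorem isOpen_tube : IsOpen (tube n) := by
  have : tube n = ⋂ j, {z | 0 < (z j).im} := by
    ext z; simp [tube]
  rw [this]
  exact isOpen_iInter_of_finite fun j =>
    isOpen_lt continuous_const (Complex.continuous_im.comp (continuous_apply j))

theorem memLp_two_of_lintegral {X : Type*} [MeasurableSpace X] {μ : Measure X} {f : X → ℂ}
    (hf : AEStronglyMeasurable f μ) (h : ∫⁻ x, ‖f x‖ₑ ^ 2 ∂μ < ⊤) : MemLp f 2 μ := by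
  refine ⟨hf, ?_⟩
  rw [eLpNorm_lt_top_iff_lintegral_rpow_enorm_lt_top (by norm_num) (by norm_num)]
  simpa using h

theorem toReal_lintegral_sq {X : Type*} [MeasurableSpace X] {μ : Measure X} {f : X → ℂ}
    (hf : AEStronglyMeasurable f μ) :
    ∫ x, ‖f x‖ ^ 2 ∂μ = (∫⁻ x, ‖f x‖ₑ ^ 2 ∂μ).toReal := by
  rw [integral_eq_lintegral_of_nonneg_ae (Eventually.of_forall fun x => by positivity)
    (by fun_prop)]
  congr 1
  refine lintegral_congr fun x => ?_
  rw [ENNReal.ofReal_pow (norm_nonneg _), ofReal_norm]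

namespace MemHardy

variable {F : (Fin n → ℂ) → ℂ}

theorem continuous_slice (hF : MemHardy F) {y : Fin n → ℝ} (hy : y ∈ octant n) :
    Continuous fun x => F (toC x y) :=
  hF.holomorphic.continuousOn.comp_continuous
    (continuous_toC.comp (continuous_id.prodMk continuous_const)) fun x => toC_mem_tube x hy

theorem lintegral_slice_le {y : Fin n → ℝ} (hy : y ∈ octant n) :
    ∫⁻ x, ‖F (toC x y)‖ₑ ^ 2 ≤ hardySq F :=
  le_iSup₂ (f := fun y (_ : y ∈ octant n) => ∫⁻ x, ‖F (toC x y)‖ₑ ^ 2) y hy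

theorem memLp_slice (hF : MemHardy F) {y : Fin n → ℝ} (hy : y ∈ octant n) :
    MemLp (fun x => F (toC x y)) 2 volume :=
  memLp_two_of_lintegral (hF.continuous_slice hy).aestronglyMeasurable
    ((lintegral_slice_le hy).trans_lt hF.bounded)

theorem integral_slice_le (hF : MemHardy F) {y : Fin n → ℝ} (hy : y ∈ octant n) :
    ∫ x, ‖F (toC x y)‖ ^ 2 ≤ (hardySq F).toReal := by
  rw [toReal_lintegral_sq (hF.continuous_slice hy).aestronglyMeasurable]
  exact ENNReal.toReal_mono hF.bounded.ne (lintegral_slice_le hy)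

theorem integrable_conj_mul (hF : MemHardy F) {y y' : Fin n → ℝ} (hy : y ∈ octant n)
    (hy' : y' ∈ octant n) :
    Integrable fun x => starRingEnd ℂ (F (toC x y')) * F (toC x y) :=
  (hF.memLp_slice hy').star.integrable_mul (hF.memLp_slice hy)

theorem integral_norm_conj_mul_le (hF : MemHardy F) {y y' : Fin n → ℝ} (hy : y ∈ octant n)
    (hy' : y' ∈ octant n) :
    ∫ x, ‖starRingEnd ℂ (F (toC x y')) * F (toC x y)‖ ≤ (hardySq F).toReal := by
  have h1 := (hF.memLp_slice hy).integrable_norm_pow two_ne_zero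
  have h2 := (hF.memLp_slice hy').integrable_norm_pow two_ne_zero
  calc ∫ x, ‖starRingEnd ℂ (F (toC x y')) * F (toC x y)‖
      ≤ ∫ x, (1 / 2 * ‖F (toC x y)‖ ^ 2 + 1 / 2 * ‖F (toC x y')‖ ^ 2) := by
        refine integral_mono (hF.integrable_conj_mul hy hy').norm
          ((h1.const_mul _).add (h2.const_mul _)) fun x => ?_
        simp only [norm_mul, RCLike.norm_conj]
        nlinarith [sq_nonneg (‖F (toC x y)‖ - ‖F (toC x y')‖)]
    _ = 1 / 2 * (∫ x, ‖F (toC x y)‖ ^ 2) + 1 / 2 * ∫ x, ‖F (toC x y')‖ ^ 2 := by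
        rw [integral_add (h1.const_mul _) (h2.const_mul _), integral_const_mul,
          integral_const_mul]
    _ ≤ _ := by linarith [hF.integral_slice_le hy, hF.integral_slice_le hy']

/-- The pairing `∫ F(x + iy) conj F(x + iy') dx` depends only on `y + y'`. -/
theorem integral_conj_mul_shift (hF : MemHardy F) {y y' v : Fin n → ℝ} (hy : y ∈ octant n)
    (hy' : y' ∈ octant n)
    (hv : y + v ∈ octant n) (hv' : y' - v ∈ octant n) :
    ∫ x, starRingEnd ℂ (F (toC x (y' - v))) * F (toC x (y + v)) =
      ∫ x, starRingEnd ℂ (F (toC x y')) * F (toC x y) := by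
  set V : Fin n → ℂ := fun j => (v j : ℂ) with hV
  -- The two conjugations make g holomorphic in τ. Its real part translates x, while its imaginary
  -- part raises y and lowers y' by the same amount, so y + y' is kept.
  set g : ℂ → (Fin n → ℝ) → ℂ := fun τ x =>
    starRingEnd ℂ (F (toC x y' + starRingEnd ℂ τ • V)) * F (toC x y + τ • V) with hg
  have hmem : ∀ s ∈ Set.Icc (0 : ℝ) 1, y + s • v ∈ octant n := by
    intro s hs
    have := convex_octant hy hv (sub_nonneg.2 hs.2) hs.1 (by ring)
    convert this using 1
    module
  have hmem' : ∀ s ∈ Set.Icc (0 : ℝ) 1, y' - s • v ∈ octant n := by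
    intro s hs
    have := convex_octant hy' hv' (sub_nonneg.2 hs.2) hs.1 (by ring)
    convert this using 1
    module
  have e1 : ∀ (r s : ℝ) x, toC x y + ((r : ℂ) + s * Complex.I) • V
      = toC (x + r • v) (y + s • v) := by
    intro r s x; ext j; simp [toC, hV]; ring
  have e2 : ∀ (r s : ℝ) x, toC x y' + (starRingEnd ℂ ((r : ℂ) + s * Complex.I)) • V
      = toC (x + r • v) (y' - s • v) := by
    intro r s x; ext j; simp [toC, hV]; ring
  have hgrs : ∀ (r s : ℝ) x, g ((r : ℂ) + s * Complex.I) x =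
      starRingEnd ℂ (F (toC (x + r • v) (y' - s • v))) * F (toC (x + r • v) (y + s • v)) := by
    intro r s x
    simp only [hg, e1, e2]
  set Φ : ℝ → ℂ := fun s => ∫ x, starRingEnd ℂ (F (toC x (y' - s • v))) * F (toC x (y + s • v))
    with hΦ
  have hΦrs : ∀ r s : ℝ, ∫ x, g ((r : ℂ) + s * Complex.I) x = Φ s := by
    intro r s
    simp only [hgrs, hΦ]
    exact integral_add_right_eq_self (fun x =>
      starRingEnd ℂ (F (toC x (y' - s • v))) * F (toC x (y + s • v))) (r • v)
  have hdiff : ∀ x, DifferentiableOn ℂ (fun τ => g τ x)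
      (Set.uIcc (0 : ℝ) 1 ×ℂ Set.uIcc (0 : ℝ) 1) := by
    intro x τ hτ
    rw [Complex.mem_reProdIm, Set.uIcc_of_le zero_le_one] at hτ
    have hτe : τ = (τ.re : ℂ) + τ.im * Complex.I := (Complex.re_add_im τ).symm
    have h1 : DifferentiableAt ℂ (fun τ : ℂ => F (toC x y + τ • V)) τ := by
      have hm : toC x y + τ • V ∈ tube n := by
        rw [hτe, e1]; exact toC_mem_tube _ (hmem _ hτ.2)
      have := hF.holomorphic.differentiableAt (isOpen_tube.mem_nhds hm)
      exact this.comp τ (f := fun τ : ℂ => toC x y + τ • V) (by fun_prop)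
    have h2 : DifferentiableAt ℂ (fun τ : ℂ => F (toC x y' + τ • V)) (starRingEnd ℂ τ) := by
      have hm : toC x y' + (starRingEnd ℂ τ) • V ∈ tube n := by
        rw [hτe, e2]; exact toC_mem_tube _ (hmem' _ hτ.2)
      have := hF.holomorphic.differentiableAt (isOpen_tube.mem_nhds hm)
      exact this.comp (starRingEnd ℂ τ) (f := fun τ : ℂ => toC x y' + τ • V) (by fun_prop)
    have h3 := h2.conj_conj
    rw [Complex.conj_conj] at h3
    exact (h3.mul h1).differentiableWithinAt
  have hrect : ∀ x, (((∫ r in (0 : ℝ)..1, g ((r : ℂ) + (0 : ℝ) * Complex.I) x) -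
      ∫ r in (0 : ℝ)..1, g ((r : ℂ) + (1 : ℝ) * Complex.I) x) +
      Complex.I • ∫ s in (0 : ℝ)..1, g (((1 : ℝ) : ℂ) + s * Complex.I) x) -
      Complex.I • (∫ s in (0 : ℝ)..1, g (((0 : ℝ) : ℂ) + s * Complex.I) x) = 0 := by
    intro x
    have := Complex.integral_boundary_rect_eq_zero_of_differentiableOn (fun τ => g τ x) 0
      (1 + Complex.I) (by simpa using hdiff x)
    simpa using this
  -- Fubini along any path c in the unit square: the L¹ norms of the slices are bounded by the Hardy
  -- norm squared, uniformly in t.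
  have hbase : ∀ (c : ℝ → ℂ), Continuous c → (∀ t ∈ Set.Icc (0 : ℝ) 1, c t ∈
      Set.Icc (0 : ℝ) 1 ×ℂ Set.Icc (0 : ℝ) 1) →
      Integrable (Function.uncurry fun t x => g (c t) x)
        ((volume.restrict (Set.uIoc (0 : ℝ) 1)).prod volume) := by
    intro c hc hcm
    rw [Set.uIoc_of_le zero_le_one]
    have hce : ∀ t, c t = ((c t).re : ℂ) + (c t).im * Complex.I :=
      fun t => (Complex.re_add_im _).symm
    have hcont : ContinuousOn (Function.uncurry fun t x => g (c t) x)
        (Set.Ioc (0 : ℝ) 1 ×ˢ Set.univ) := by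
      have k1 : ContinuousOn (fun p : ℝ × (Fin n → ℝ) => F (toC p.2 y + c p.1 • V))
          (Set.Ioc (0 : ℝ) 1 ×ˢ Set.univ) := by
        refine hF.holomorphic.continuousOn.comp (Continuous.continuousOn ?_) ?_
        · exact (continuous_toC.comp (continuous_snd.prodMk continuous_const)).add
            ((hc.comp continuous_fst).smul continuous_const)
        · intro p hp
          show toC p.2 y + c p.1 • V ∈ tube n
          rw [hce p.1, e1]
          exact toC_mem_tube _ (hmem _ (Complex.mem_reProdIm.1
            (hcm _ (Set.Ioc_subset_Icc_self hp.1))).2)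
      have k2 : ContinuousOn (fun p : ℝ × (Fin n → ℝ) =>
          F (toC p.2 y' + starRingEnd ℂ (c p.1) • V)) (Set.Ioc (0 : ℝ) 1 ×ˢ Set.univ) := by
        refine hF.holomorphic.continuousOn.comp (Continuous.continuousOn ?_) ?_
        · exact (continuous_toC.comp (continuous_snd.prodMk continuous_const)).add
            ((Complex.continuous_conj.comp (hc.comp continuous_fst)).smul continuous_const)
        · intro p hp
          show toC p.2 y' + starRingEnd ℂ (c p.1) • V ∈ tube n
          rw [hce p.1, e2]
          exact toC_mem_tube _ (hmem' _ (Complex.mem_reProdIm.1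
            (hcm _ (Set.Ioc_subset_Icc_self hp.1))).2)
      exact (Complex.continuous_conj.comp_continuousOn k2).mul k1
    have hms : AEStronglyMeasurable (Function.uncurry fun t x => g (c t) x)
        ((volume.restrict (Set.Ioc (0 : ℝ) 1)).prod volume) := by
      have := hcont.aestronglyMeasurable (μ := (volume : Measure ℝ).prod volume)
        (measurableSet_Ioc.prod MeasurableSet.univ)
      rwa [← Measure.prod_restrict, Measure.restrict_univ] at this
    have hint : ∀ t ∈ Set.Ioc (0 : ℝ) 1, Integrable (fun x => g (c t) x) ∧
        ∫ x, ‖g (c t) x‖ ≤ (hardySq F).toReal := by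
      intro t ht
      have hm := (Complex.mem_reProdIm.1 (hcm _ (Set.Ioc_subset_Icc_self ht))).2
      rw [hce t]
      simp only [hgrs]
      exact ⟨(hF.integrable_conj_mul (hmem _ hm) (hmem' _ hm)).comp_add_right ((c t).re • v),
        (integral_add_right_eq_self (fun x => ‖starRingEnd ℂ (F (toC x (y' - (c t).im • v))) *
          F (toC x (y + (c t).im • v))‖) ((c t).re • v)).le.trans
          (hF.integral_norm_conj_mul_le (hmem _ hm) (hmem' _ hm))⟩
    rw [integrable_prod_iff hms]
    constructor
    · filter_upwards [ae_restrict_mem measurableSet_Ioc] with t ht using (hint t ht).1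
    · refine Integrable.of_bound hms.norm.integral_prod_right'
        (hardySq F).toReal ?_
      filter_upwards [ae_restrict_mem measurableSet_Ioc] with t ht
      rw [Real.norm_of_nonneg (integral_nonneg fun x => norm_nonneg _)]
      exact (hint t ht).2
  have hI0 := hbase (fun r => (r : ℂ) + (0 : ℝ) * Complex.I) (by fun_prop)
    (fun t ht => by simpa [Complex.mem_reProdIm] using ht)
  have hI1 := hbase (fun r => (r : ℂ) + (1 : ℝ) * Complex.I) (by fun_prop)
    (fun t ht => by simpa [Complex.mem_reProdIm] using ht)
  have hJ0 := hbase (fun s => ((0 : ℝ) : ℂ) + s * Complex.I) (by fun_prop)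
    (fun t ht => by simpa [Complex.mem_reProdIm] using ht)
  have hJ1 := hbase (fun s => ((1 : ℝ) : ℂ) + s * Complex.I) (by fun_prop)
    (fun t ht => by simpa [Complex.mem_reProdIm] using ht)
  have sw : ∀ c : ℝ → ℂ, Integrable (Function.uncurry fun t x => g (c t) x)
        ((volume.restrict (Set.uIoc (0 : ℝ) 1)).prod volume) →
      (∫ x, ∫ t in (0 : ℝ)..1, g (c t) x) = ∫ t in (0 : ℝ)..1, ∫ x, g (c t) x :=
    fun c h => (intervalIntegral_integral_swap h).symm
  have si : ∀ c : ℝ → ℂ, Integrable (Function.uncurry fun t x => g (c t) x)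
        ((volume.restrict (Set.uIoc (0 : ℝ) 1)).prod volume) →
      Integrable fun x => ∫ t in (0 : ℝ)..1, g (c t) x := by
    intro c h
    rw [Set.uIoc_of_le zero_le_one] at h
    simp only [intervalIntegral.integral_of_le zero_le_one]
    exact h.integral_prod_right
  -- Integrate Cauchy's theorem for the unit square over x. By translation invariance the two
  -- vertical sides contribute the same and cancel; the horizontal sides leave Φ 0 = Φ 1.
  have htot := integral_congr_ae (μ := volume) (Eventually.of_forall hrect)
  rw [integral_sub, integral_add, integral_sub, integral_smul, integral_smul, sw _ hI0, sw _ hI1,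
    sw _ hJ0, sw _ hJ1] at htot
  rotate_left
  · exact si _ hI0
  · exact si _ hI1
  · exact (si _ hI0).sub (si _ hI1)
  · exact (si _ hJ1).smul Complex.I
  · exact ((si _ hI0).sub (si _ hI1)).add ((si _ hJ1).smul Complex.I)
  · exact (si _ hJ0).smul Complex.I
  simp only [hΦrs] at htot
  have h01 : Φ 0 = Φ 1 := by
    simpa [sub_eq_zero] using htot
  simpa [hΦ] using h01.symm

end MemHardy
-- Existence and uniqueness of the L² boundary limit
theorem tendsto_const_nhdsWithin_octant :
    Tendsto (fun t : ℝ => fun _ : Fin n => t) (𝓝[>] 0) (𝓝[octant n] 0) := by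
  refine tendsto_nhdsWithin_iff.2 ⟨?_, ?_⟩
  · exact (Continuous.tendsto' (by fun_prop) _ _ rfl).mono_left nhdsWithin_le_nhds
  · filter_upwards [self_mem_nhdsWithin] with t ht j using ht

instance neBot_nhdsWithin_octant : (𝓝[octant n] (0 : Fin n → ℝ)).NeBot :=
  tendsto_const_nhdsWithin_octant.neBot

theorem inner_toLp {X : Type*} [MeasurableSpace X] {μ : Measure X} {f g : X → ℂ}
    (hf : MemLp f 2 μ) (hg : MemLp g 2 μ) :
    inner ℂ (hf.toLp f) (hg.toLp g) = ∫ x, starRingEnd ℂ (f x) * g x ∂μ := by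
  rw [L2.inner_def]
  refine integral_congr_ae ?_
  filter_upwards [hf.coeFn_toLp, hg.coeFn_toLp] with x h1 h2
  rw [h1, h2, RCLike.inner_apply, mul_comm]

theorem norm_sq_toLp {X : Type*} [MeasurableSpace X] {μ : Measure X} {f : X → ℂ}
    (hf : MemLp f 2 μ) : ‖hf.toLp f‖ ^ 2 = ∫ x, ‖f x‖ ^ 2 ∂μ := by
  have h := inner_toLp hf hf
  rw [inner_self_eq_norm_sq_to_K] at h
  have h2 : (∫ x, starRingEnd ℂ (f x) * f x ∂μ) = ((∫ x, ‖f x‖ ^ 2 ∂μ : ℝ) : ℂ) := by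
    rw [← integral_complex_ofReal]
    refine integral_congr_ae (Eventually.of_forall fun x => ?_)
    simp [Complex.conj_mul']
  rw [h2] at h
  exact Complex.ofReal_injective (by push_cast at h ⊢; exact h)

namespace MemHardy

variable {F : (Fin n → ℂ) → ℂ}

/-- The slice `x ↦ F (x + iy)` as an element of `L²(ℝⁿ)`. -/
noncomputable def sliceLp (hF : MemHardy F) (y : octant n) : Lp ℂ 2 (volume : Measure (Fin n → ℝ)) :=
  (hF.memLp_slice y.2).toLp _

/-- The midpoint of two points of the octant. -/
noncomputable def mid (y y' : octant n) : octant n :=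
  ⟨(1 / 2 : ℝ) • ((y : Fin n → ℝ) + y'), fun j => by
    have := y.2 j
    have := y'.2 j
    simp only [Pi.smul_apply, Pi.add_apply, smul_eq_mul]
    linarith⟩

/-- The shift by half of y - y' moves both heights to their midpoint without changing their sum. -/
theorem inner_sliceLp (hF : MemHardy F) (y y' : octant n) :
    inner ℂ (hF.sliceLp y) (hF.sliceLp y') = ((‖hF.sliceLp (mid y y')‖ ^ 2 : ℝ) : ℂ) := by
  have key := hF.integral_conj_mul_shift (v := (1 / 2 : ℝ) • ((y : Fin n → ℝ) - y')) y'.2 y.2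
    (by convert (mid y y').2 using 1; simp only [mid]; module)
    (by convert (mid y y').2 using 1; simp only [mid]; module)
  have e1 : (y' : Fin n → ℝ) + (1 / 2 : ℝ) • ((y : Fin n → ℝ) - y') = mid y y' := by
    simp only [mid]; module
  have e2 : (y : Fin n → ℝ) - (1 / 2 : ℝ) • ((y : Fin n → ℝ) - y') = mid y y' := by
    simp only [mid]; module
  rw [e1, e2] at key
  have h := inner_self_eq_norm_sq_to_K (𝕜 := ℂ) (hF.sliceLp (mid y y'))
  rw [sliceLp, sliceLp, inner_toLp, ← key]
  rw [sliceLp, inner_toLp] at h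
  rw [h, sliceLp]
  norm_cast

theorem norm_sq_sliceLp_le (hF : MemHardy F) (y : octant n) :
    ‖hF.sliceLp y‖ ^ 2 ≤ (hardySq F).toReal := by
  rw [sliceLp, norm_sq_toLp]
  exact hF.integral_slice_le y.2

theorem norm_sub_sliceLp_sq (hF : MemHardy F) (y y' : octant n) :
    ‖hF.sliceLp y - hF.sliceLp y'‖ ^ 2 =
      ‖hF.sliceLp y‖ ^ 2 + ‖hF.sliceLp y'‖ ^ 2 - 2 * ‖hF.sliceLp (mid y y')‖ ^ 2 := by
  rw [@norm_sub_sq ℂ, inner_sliceLp]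
  simp only [RCLike.re_to_complex, Complex.ofReal_re]
  ring

/-- Along the arithmetic progression through y and y', which never leaves the octant, the squared
norms form a convex sequence because ‖F_y - F_y'‖² ≥ 0. A convex sequence with a positive first
increment grows at least linearly, contradicting the Hardy bound. -/
theorem norm_sq_sliceLp_antitone (hF : MemHardy F) {y y' : octant n} (h : ∀ j, y.1 j ≤ y'.1 j) :
    ‖hF.sliceLp y'‖ ^ 2 ≤ ‖hF.sliceLp y‖ ^ 2 := by
  set p : ℕ → octant n := fun k => ⟨y.1 + (k : ℝ) • (y'.1 - y.1), fun j => by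
    have h1 := y.2 j
    have h2 : 0 ≤ (k : ℝ) * (y'.1 j - y.1 j) := mul_nonneg (by positivity) (sub_nonneg.2 (h j))
    simp only [Pi.smul_apply, Pi.add_apply, Pi.sub_apply, smul_eq_mul]
    linarith⟩ with hp
  set a : ℕ → ℝ := fun k => ‖hF.sliceLp (p k)‖ ^ 2 with ha
  have hmid : ∀ k, mid (p k) (p (k + 2)) = p (k + 1) := by
    intro k
    apply Subtype.ext
    simp only [mid, hp]
    push_cast
    module
  have hconv : ∀ k, 2 * a (k + 1) ≤ a k + a (k + 2) := by
    intro k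
    have := hF.norm_sub_sliceLp_sq (p k) (p (k + 2))
    rw [hmid] at this
    have h0 := sq_nonneg ‖hF.sliceLp (p k) - hF.sliceLp (p (k + 2))‖
    simp only [ha]
    linarith
  have hp0 : p 0 = y := Subtype.ext (by simp [hp])
  have hp1 : p 1 = y' := Subtype.ext (by simp [hp])
  by_contra! hlt
  have hd : ∀ k, a 1 - a 0 ≤ a (k + 1) - a k := by
    intro k
    induction k with
    | zero => simp
    | succ k ih => have := hconv k; linarith
  have hgrow : ∀ k : ℕ, a 0 + k * (a 1 - a 0) ≤ a k := by
    intro k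
    induction k with
    | zero => simp
    | succ k ih => have := hd k; push_cast; linarith
  have hpos : 0 < a 1 - a 0 := by simp only [ha, hp0, hp1]; linarith
  obtain ⟨k, hk⟩ := exists_nat_gt ((hardySq F).toReal / (a 1 - a 0))
  rw [div_lt_iff₀ hpos] at hk
  have h1 := hF.norm_sq_sliceLp_le (p k)
  have h2 := hgrow k
  have h3 : 0 ≤ a 0 := by simp only [ha]; positivity
  simp only [ha] at h1 h2 h3 hk
  linarith

/-- Choose y0 whose squared norm exceeds the supremum S minus ε²/2. If y and y' lie below y0, so
does their midpoint; by monotonicity ‖F_y - F_y'‖² ≤ 2S - 2‖F_y0‖² < ε². -/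
theorem cauchy_sliceLp (hF : MemHardy F) :
    Cauchy (map hF.sliceLp (comap Subtype.val (𝓝 (0 : Fin n → ℝ)))) := by
  have hne : (comap (Subtype.val : octant n → _) (𝓝 (0 : Fin n → ℝ))).NeBot := by
    rw [← map_neBot_iff (Subtype.val : octant n → _), subtype_coe_map_comap]
    exact neBot_nhdsWithin_octant
  obtain ⟨y1⟩ := hne.nonempty
  refine Metric.cauchy_iff.2 ⟨hne.map _, fun ε hε => ?_⟩
  set S := ⨆ y, ‖hF.sliceLp y‖ ^ 2 with hS
  have hbdd : BddAbove (Set.range fun y => ‖hF.sliceLp y‖ ^ 2) :=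
    ⟨_, by rintro _ ⟨y, rfl⟩; exact hF.norm_sq_sliceLp_le y⟩
  have hlt : S - ε ^ 2 / 2 < S := by have : 0 < ε ^ 2 := by positivity
                                     linarith
  have : Nonempty (octant n) := ⟨y1⟩
  obtain ⟨y0, hy0⟩ := exists_lt_of_lt_ciSup hlt
  refine ⟨hF.sliceLp '' {y | ∀ j, y.1 j < y0.1 j}, image_mem_map ⟨{y | ∀ j, y j < y0.1 j}, ?_,
    fun y hy => hy⟩, ?_⟩
  · have : IsOpen {y : Fin n → ℝ | ∀ j, y j < y0.1 j} := by
      simp only [Set.ofPred_forall]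
      exact isOpen_iInter_of_finite fun j => isOpen_lt (continuous_apply j) continuous_const
    exact this.mem_nhds fun j => y0.2 j
  · rintro _ ⟨y, hy, rfl⟩ _ ⟨y', hy', rfl⟩
    rw [dist_eq_norm]
    refine lt_of_pow_lt_pow_left₀ 2 hε.le ?_
    rw [norm_sub_sliceLp_sq]
    have h1 := le_ciSup hbdd y
    have h2 := le_ciSup hbdd y'
    have h3 := hF.norm_sq_sliceLp_antitone (y := mid y y') (y' := y0) fun j => by
      have := hy j
      have := hy' j
      simp only [mid, Pi.smul_apply, Pi.add_apply, smul_eq_mul]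
      linarith
    simp only [← hS] at h1 h2
    linarith

/-- Functions in the Hardy space have an unrestricted `L²` boundary limit. -/
theorem exists_isBoundaryValue (hF : MemHardy F) : ∃ f, IsBoundaryValue F f := by
  have hne : (comap (Subtype.val : octant n → _) (𝓝 (0 : Fin n → ℝ))).NeBot := by
    rw [← map_neBot_iff (Subtype.val : octant n → _), subtype_coe_map_comap]
    exact neBot_nhdsWithin_octant
  obtain ⟨u, hu⟩ := cauchy_map_iff_exists_tendsto.1 hF.cauchy_sliceLp
  refine ⟨u, Lp.memLp u, ?_⟩
  rw [nhdsWithin, ← subtype_coe_map_comap, tendsto_map'_iff]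
  have h := (Lp.tendsto_Lp_iff_tendsto_eLpNorm' _ _).1 hu
  refine h.congr fun y => eLpNorm_congr_ae ?_
  filter_upwards [(hF.memLp_slice y.2).coeFn_toLp] with x hx
  simp only [Pi.sub_apply, sliceLp, hx]

end MemHardy

theorem IsBoundaryValue.ae_eq {F : (Fin n → ℂ) → ℂ} {f g : (Fin n → ℝ) → ℂ}
    (hF : MemHardy F) (hf : IsBoundaryValue F f) (hg : IsBoundaryValue F g) : f =ᵐ[volume] g := by
  have h0 : eLpNorm (f - g) 2 volume = 0 := by
    have ht := hf.tendsto.add hg.tendsto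
    rw [add_zero] at ht
    refine le_antisymm (ge_of_tendsto ht ?_) bot_le
    filter_upwards [self_mem_nhdsWithin] with y hy
    have m := (hF.memLp_slice hy).aestronglyMeasurable
    have := eLpNorm_sub_le (p := 2) (m.sub hg.memLp.aestronglyMeasurable)
      (m.sub hf.memLp.aestronglyMeasurable) (by norm_num)
    rw [sub_sub_sub_cancel_left, add_comm] at this
    exact this
  rw [eLpNorm_eq_zero_iff (hf.memLp.sub hg.memLp).aestronglyMeasurable (by norm_num)] at h0
  filter_upwards [h0] with x hx
  simpa [sub_eq_zero] using hx

theorem MemHardy.isBoundaryValue_boundaryValue {F : (Fin n → ℂ) → ℂ} (hF : MemHardy F) :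
    IsBoundaryValue F (boundaryValue F) := by
  have h := hF.exists_isBoundaryValue
  rw [boundaryValue, dif_pos h]
  exact h.choose_spec

/-! ### Norm integrals on the real line -/

/-- The integral `∫ (1 + x²)^{-(a+1)} dx`. -/
noncomputable def bumpIntegral (a : ℕ) : ℝ := ∫ x : ℝ, ((1 + x ^ 2) ^ (a + 1))⁻¹

theorem integrable_inv_one_add_sq_pow (a : ℕ) :
    Integrable fun x : ℝ => ((1 + x ^ 2) ^ (a + 1))⁻¹ := by
  refine integrable_inv_one_add_sq.mono' (Continuous.aestronglyMeasurable ?_)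
    (Eventually.of_forall fun x => ?_)
  · exact Continuous.inv₀ (by fun_prop) fun x => by positivity
  · rw [Real.norm_of_nonneg (by positivity)]
    refine inv_anti₀ (by positivity) ?_
    exact le_self_pow₀ (by nlinarith [sq_nonneg x]) (by omega)

/-- Since 1 + x² ≤ exp(x²), the integrand dominates a Gaussian. Apart from positivity, this lower
bound is all that the decay estimates use about the integral. -/
theorem sqrt_le_bumpIntegral (a : ℕ) : √(Real.pi / (a + 1)) ≤ bumpIntegral a := by
  rw [← integral_gaussian]
  refine integral_mono (integrable_exp_neg_mul_sq (by positivity))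
    (integrable_inv_one_add_sq_pow a) fun x => ?_
  simp only
  rw [neg_mul, Real.exp_neg]
  refine inv_anti₀ (by positivity) ?_
  have h := Real.add_one_le_exp (x ^ 2)
  calc (1 + x ^ 2) ^ (a + 1) ≤ Real.exp (x ^ 2) ^ (a + 1) := by
        gcongr; linarith
    _ = _ := by rw [← Real.exp_nat_mul]; push_cast; rfl

theorem bumpIntegral_pos (a : ℕ) : 0 < bumpIntegral a :=
  (Real.sqrt_pos.2 (by positivity)).trans_le (sqrt_le_bumpIntegral a)

theorem inv_sub_sq_add_sq_pow_eq (a : ℕ) (c : ℝ) {y : ℝ} (hy : y ≠ 0) (x : ℝ) :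
    (((x - c) ^ 2 + y ^ 2) ^ (a + 1))⁻¹ =
      (y ^ (2 * a + 2))⁻¹ * ((1 + ((x - c) / y) ^ 2) ^ (a + 1))⁻¹ := by
  rw [← mul_inv, show 2 * a + 2 = 2 * (a + 1) by ring, pow_mul, ← mul_pow]
  congr 2
  field_simp
  ring

theorem integrable_inv_sub_sq_add_sq_pow (a : ℕ) (c : ℝ) {y : ℝ} (hy : y ≠ 0) :
    Integrable fun x : ℝ => (((x - c) ^ 2 + y ^ 2) ^ (a + 1))⁻¹ := by
  simp only [inv_sub_sq_add_sq_pow_eq a c hy]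
  exact (((integrable_inv_one_add_sq_pow a).comp_div hy).comp_sub_right c).const_mul _

theorem integral_inv_sub_sq_add_sq_pow (a : ℕ) (c : ℝ) {y : ℝ} (hy : 0 < y) :
    ∫ x : ℝ, (((x - c) ^ 2 + y ^ 2) ^ (a + 1))⁻¹ = bumpIntegral a / y ^ (2 * a + 1) := by
  simp only [inv_sub_sq_add_sq_pow_eq a c hy.ne']
  rw [integral_const_mul,
    integral_sub_right_eq_self (fun x : ℝ => ((1 + (x / y) ^ 2) ^ (a + 1))⁻¹) c,
    Measure.integral_comp_div (fun x : ℝ => ((1 + x ^ 2) ^ (a + 1))⁻¹) y, ← bumpIntegral,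
    abs_of_pos hy, smul_eq_mul]
  field_simp
  ring

/-! ### Pairings of inverse powers, by explicit primitives -/

/-- The power `(x - ζ)^{-(a+1)}` on the real line. -/
noncomputable def invPow (a : ℕ) (ζ : ℂ) (x : ℝ) : ℂ := (((x : ℂ) - ζ) ^ (a + 1))⁻¹

theorem ofReal_sub_ne_zero {ζ : ℂ} (hζ : ζ.im ≠ 0) (x : ℝ) : (x : ℂ) - ζ ≠ 0 := by
  intro h
  have := congrArg Complex.im h
  simp at this
  exact hζ this

theorem continuous_invPow (a : ℕ) {ζ : ℂ} (hζ : ζ.im ≠ 0) : Continuous (invPow a ζ) := by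
  unfold invPow
  exact Continuous.inv₀ (by fun_prop) fun x => pow_ne_zero _ (ofReal_sub_ne_zero hζ x)

theorem norm_invPow_sq (a : ℕ) (ζ : ℂ) (x : ℝ) :
    ‖invPow a ζ x‖ ^ 2 = (((x - ζ.re) ^ 2 + ζ.im ^ 2) ^ (a + 1))⁻¹ := by
  rw [invPow, norm_inv, norm_pow, inv_pow, ← pow_mul, mul_comm (a + 1) 2, pow_mul,
    Complex.sq_norm, Complex.normSq_apply]
  congr 2
  simp
  ring

theorem memLp_invPow (a : ℕ) {ζ : ℂ} (hζ : ζ.im ≠ 0) : MemLp (invPow a ζ) 2 volume := by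
  rw [memLp_two_iff_integrable_sq_norm (continuous_invPow a hζ).aestronglyMeasurable]
  simp only [norm_invPow_sq]
  exact integrable_inv_sub_sq_add_sq_pow a _ hζ

theorem integrable_invPow_mul (a b : ℕ) {ω ζ : ℂ} (hω : ω.im ≠ 0) (hζ : ζ.im ≠ 0) :
    Integrable fun x => invPow b ω x * invPow a ζ x :=
  (memLp_invPow b hω).integrable_mul (memLp_invPow a hζ)

theorem invPow_zero_mul (a : ℕ) (ζ : ℂ) (x : ℝ) :
    invPow 0 ζ x * invPow a ζ x = invPow (a + 1) ζ x := by
  simp only [invPow, ← mul_inv]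
  ring

theorem tendsto_invPow (a : ℕ) (ζ : ℂ) : Tendsto (invPow a ζ) (cocompact ℝ) (𝓝 0) := by
  refine tendsto_inv₀_cobounded.comp ?_
  refine (tendsto_pow_cobounded_cobounded (by omega)).comp ?_
  rw [← tendsto_norm_atTop_iff_cobounded]
  refine tendsto_atTop_mono (fun x : ℝ => ?_)
    (tendsto_atTop_add_const_right _ (-‖ζ‖) (tendsto_norm_cocompact_atTop (E := ℝ)))
  have := norm_sub_norm_le (x : ℂ) ζ
  rw [Complex.norm_real] at this
  linarith

theorem integral_invPow_succ (a : ℕ) {ζ : ℂ} (hζ : ζ.im ≠ 0) : ∫ x, invPow (a + 1) ζ x = 0 := by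
  have hd : ∀ x : ℝ, HasDerivAt (fun x => -((a : ℂ) + 1)⁻¹ * invPow a ζ x) (invPow (a + 1) ζ x) x := by
    intro x
    have hne := ofReal_sub_ne_zero hζ x
    have h0 : HasDerivAt (fun t : ℝ => (t : ℂ) - ζ) 1 x := by
      simpa using (Complex.ofRealCLM.hasDerivAt (x := x)).sub_const ζ
    have h1 := ((h0.pow (a + 1)).inv (pow_ne_zero _ hne)).const_mul (-((a : ℂ) + 1)⁻¹)
    refine h1.congr_deriv ?_
    have ha : (a : ℂ) + 1 ≠ 0 := by exact_mod_cast a.succ_ne_zero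
    simp only [invPow]
    push_cast
    simp only [Pi.pow_apply]
    field_simp
    ring
  have hi : Integrable (invPow (a + 1) ζ) := by
    refine (integrable_invPow_mul a 0 hζ hζ).congr (Eventually.of_forall fun x => ?_)
    exact invPow_zero_mul a ζ x
  have ht : Tendsto (fun x => -((a : ℂ) + 1)⁻¹ * invPow a ζ x) (cocompact ℝ) (𝓝 0) := by
    simpa using (tendsto_invPow a ζ).const_mul (-((a : ℂ) + 1)⁻¹)
  rw [cocompact_eq_atBot_atTop, tendsto_sup] at ht
  simpa using integral_of_hasDerivAt_of_tendsto hd hi ht.1 ht.2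

theorem ofReal_sub_mem_slitPlane {ζ : ℂ} (hζ : ζ.im ≠ 0) (x : ℝ) :
    (x : ℂ) - ζ ∈ Complex.slitPlane := by
  right
  simpa using hζ

theorem tendsto_div_atTop_zero (ω : ℂ) :
    Tendsto (fun x : ℝ => ω / (x : ℂ)) atTop (𝓝 0) := by
  have h : Tendsto (fun x : ℝ => ((x⁻¹ : ℝ) : ℂ)) atTop (𝓝 ((0 : ℝ) : ℂ)) :=
    (Complex.continuous_ofReal.tendsto 0).comp tendsto_inv_atTop_zero
  simpa [div_eq_mul_inv] using h.const_mul ω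

theorem tendsto_log_sub_log_atTop (ω ζ : ℂ) :
    Tendsto (fun x : ℝ => Complex.log ((x : ℂ) - ω) - Complex.log ((x : ℂ) - ζ)) atTop (𝓝 0) := by
  have key : ∀ ω : ℂ, Tendsto (fun x : ℝ => Complex.log (1 - ω / (x : ℂ))) atTop (𝓝 0) := by
    intro ω
    have h1 : Tendsto (fun x : ℝ => 1 - ω / (x : ℂ)) atTop (𝓝 1) := by
      simpa using (tendsto_div_atTop_zero ω).const_sub 1
    simpa using h1.clog (by simp)
  have hne : ∀ ω : ℂ, ∀ᶠ x : ℝ in atTop, 1 - ω / (x : ℂ) ≠ 0 := fun ω => by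
    have h1 : Tendsto (fun x : ℝ => 1 - ω / (x : ℂ)) atTop (𝓝 1) := by
      simpa using (tendsto_div_atTop_zero ω).const_sub 1
    exact h1.eventually_ne one_ne_zero
  have h := (key ω).sub (key ζ)
  rw [sub_zero] at h
  refine h.congr' ?_
  filter_upwards [hne ω, hne ζ, eventually_gt_atTop 0] with x h1 h2 hx
  have hx' : (x : ℂ) ≠ 0 := by exact_mod_cast hx.ne'
  have e : ∀ ω : ℂ, (x : ℂ) - ω = (x : ℂ) * (1 - ω / x) := fun ω => by field_simp
  rw [e ω, e ζ, Complex.log_ofReal_mul hx h1, Complex.log_ofReal_mul hx h2]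
  ring

/-- After division by |x|, the two arguments tend to -1 from above and from below respectively,
where the principal logarithm tends to πi and -πi; the terms log |x| cancel. -/
theorem tendsto_log_sub_log_atBot {ω ζ : ℂ} (hω : ω.im < 0) (hζ : 0 < ζ.im) :
    Tendsto (fun x : ℝ => Complex.log ((x : ℂ) - ω) - Complex.log ((x : ℂ) - ζ)) atBot
      (𝓝 (2 * Real.pi * Complex.I)) := by
  have hlim : ∀ ω : ℂ, Tendsto (fun x : ℝ => -1 - ω / (x : ℂ)) atTop (𝓝 (-1)) := fun ω => by
    simpa using (tendsto_div_atTop_zero ω).const_sub (-1)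
  have him : ∀ (ω : ℂ) (x : ℝ), (-1 - ω / (x : ℂ)).im = - (ω.im / x) := by
    intro ω x
    simp [Complex.div_ofReal_im]
  have k1 : Tendsto (fun x : ℝ => Complex.log (-1 - ω / (x : ℂ))) atTop
      (𝓝 (Real.pi * Complex.I)) := by
    have h := Complex.tendsto_log_nhdsWithin_im_nonneg_of_re_neg_of_im_zero
      (z := -1) (by simp) (by simp)
    simp only [norm_neg, norm_one, Real.log_one, Complex.ofReal_zero, zero_add] at h
    refine h.comp (tendsto_nhdsWithin_iff.2 ⟨hlim ω, ?_⟩)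
    filter_upwards [eventually_gt_atTop 0] with x hx
    show 0 ≤ _
    rw [him, neg_nonneg]
    exact div_nonpos_of_nonpos_of_nonneg hω.le hx.le
  have k2 : Tendsto (fun x : ℝ => Complex.log (-1 - ζ / (x : ℂ))) atTop
      (𝓝 (-(Real.pi * Complex.I))) := by
    have h := Complex.tendsto_log_nhdsWithin_im_neg_of_re_neg_of_im_zero
      (z := -1) (by simp) (by simp)
    simp only [norm_neg, norm_one, Real.log_one, Complex.ofReal_zero, zero_sub] at h
    refine h.comp (tendsto_nhdsWithin_iff.2 ⟨hlim ζ, ?_⟩)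
    filter_upwards [eventually_gt_atTop 0] with x hx
    show _ < 0
    rw [him, neg_lt_zero]
    exact div_pos hζ hx
  have hne : ∀ ω : ℂ, ∀ᶠ x : ℝ in atTop, -1 - ω / (x : ℂ) ≠ 0 := fun ω =>
    (hlim ω).eventually_ne (by simp)
  have h := k1.sub k2
  rw [show Real.pi * Complex.I - -(Real.pi * Complex.I) = 2 * Real.pi * Complex.I by ring] at h
  have h' : Tendsto ((fun x : ℝ => Complex.log ((x : ℂ) - ω) - Complex.log ((x : ℂ) - ζ)) ∘ Neg.neg)
      atTop (𝓝 (2 * Real.pi * Complex.I)) := by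
    refine h.congr' ?_
    filter_upwards [hne ω, hne ζ, eventually_gt_atTop 0] with x h1 h2 hx
    have hx' : (x : ℂ) ≠ 0 := by exact_mod_cast hx.ne'
    have e : ∀ ω : ℂ, ((-x : ℝ) : ℂ) - ω = (x : ℂ) * (-1 - ω / x) := fun ω => by
      push_cast; field_simp
    simp only [Function.comp]
    rw [e ω, e ζ, Complex.log_ofReal_mul hx h1, Complex.log_ofReal_mul hx h2]
    ring
  have := h'.comp tendsto_neg_atBot_atTop
  simpa [Function.comp_def] using this

/-- Partial fractions lower the power of x - ζ at the cost of a factor 1/(ω - ζ) and a term with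
integral zero. At the bottom, a difference of logarithms is a primitive, and its jump 2πi is the
residue. -/
theorem integral_invPow_zero_mul_invPow (a : ℕ) {ω ζ : ℂ} (hω : ω.im < 0) (hζ : 0 < ζ.im) :
    ∫ x, invPow 0 ω x * invPow a ζ x = -(2 * Real.pi * Complex.I) / (ω - ζ) ^ (a + 1) := by
  have hne : ω - ζ ≠ 0 := by
    intro h
    have := congrArg Complex.im h
    simp at this
    linarith
  have hsplit : ∀ x, invPow 0 ω x * invPow 0 ζ x = (invPow 0 ω x - invPow 0 ζ x) / (ω - ζ) := by
    intro x
    have h1 := ofReal_sub_ne_zero hω.ne x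
    have h2 := ofReal_sub_ne_zero hζ.ne' x
    simp only [invPow, zero_add, pow_one]
    field_simp
    ring
  induction a with
  | zero =>
    have hd : ∀ x : ℝ, HasDerivAt (fun x : ℝ => (Complex.log ((x : ℂ) - ω) -
        Complex.log ((x : ℂ) - ζ)) / (ω - ζ)) (invPow 0 ω x * invPow 0 ζ x) x := by
      intro x
      have h0 : ∀ ω : ℂ, HasDerivAt (fun t : ℝ => (t : ℂ) - ω) 1 x := fun ω => by
        simpa using (Complex.ofRealCLM.hasDerivAt (x := x)).sub_const ω
      have h1 := (((h0 ω).clog_real (ofReal_sub_mem_slitPlane hω.ne x)).sub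
        ((h0 ζ).clog_real (ofReal_sub_mem_slitPlane hζ.ne' x))).div_const (ω - ζ)
      refine h1.congr_deriv ?_
      rw [hsplit]
      simp [invPow]
    rw [integral_of_hasDerivAt_of_tendsto hd (integrable_invPow_mul 0 0 hω.ne hζ.ne')
      ((tendsto_log_sub_log_atBot hω hζ).div_const _)
      ((tendsto_log_sub_log_atTop ω ζ).div_const _)]
    simp [neg_div]
  | succ a ih =>
    have hrec : ∀ x, invPow 0 ω x * invPow (a + 1) ζ x =
        (invPow 0 ω x * invPow a ζ x - invPow (a + 1) ζ x) / (ω - ζ) := by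
      intro x
      rw [← invPow_zero_mul, ← mul_assoc, hsplit]
      ring
    have hi : Integrable (invPow (a + 1) ζ) :=
      (integrable_invPow_mul a 0 hζ.ne' hζ.ne').congr
        (Eventually.of_forall fun x => invPow_zero_mul a ζ x)
    simp only [hrec]
    rw [integral_div, integral_sub (integrable_invPow_mul a 0 hω.ne hζ.ne') hi, ih,
      integral_invPow_succ a hζ.ne']
    rw [sub_zero, pow_succ _ (a + 1), div_div]

/-! ### The one-dimensional kernel derivatives -/

/-- One factor of the closed form of the kernel derivatives. -/
noncomputable def factor (a : ℕ) (z w : ℂ) : ℂ :=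
  -1 / (2 * (Real.pi : ℂ) * Complex.I) * (a.factorial / (w - starRingEnd ℂ z) ^ (a + 1))

/-- The squared `L²(ℝ)` norm of `factor a z` for `z.im = y > 0`. -/
noncomputable def factorSq (a : ℕ) (y : ℝ) : ℝ :=
  (a.factorial / (2 * Real.pi)) ^ 2 * (bumpIntegral a / y ^ (2 * a + 1))

theorem factorSq_pos (a : ℕ) {y : ℝ} (hy : 0 < y) : 0 < factorSq a y := by
  have := bumpIntegral_pos a
  have := Nat.factorial_pos a
  unfold factorSq
  positivity

/-- Only w - conj z enters, so raising w by η amounts to raising z by η. Slices of the kernel are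
thus boundary kernels with a shifted parameter. -/
theorem factor_add_I_mul (a : ℕ) (z : ℂ) (x η : ℝ) :
    factor a z (x + Complex.I * η) = factor a (z + Complex.I * η) x := by
  simp only [factor, map_add, map_mul, Complex.conj_I, Complex.conj_ofReal]
  ring

theorem factor_ofReal (a : ℕ) (z : ℂ) (x : ℝ) :
    factor a z x = -1 / (2 * (Real.pi : ℂ) * Complex.I) * a.factorial *
      invPow a (starRingEnd ℂ z) x := by
  rw [factor, invPow]
  ring

theorem continuous_factor_ofReal (a : ℕ) {z : ℂ} (hz : 0 < z.im) :
    Continuous fun x : ℝ => factor a z x := by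
  simp only [factor_ofReal]
  exact continuous_const.mul (continuous_invPow a (by simpa using hz.ne'))

theorem norm_factor (a : ℕ) (z w : ℂ) :
    ‖factor a z w‖ = a.factorial / (2 * Real.pi) / ‖w - starRingEnd ℂ z‖ ^ (a + 1) := by
  simp [factor, abs_of_pos Real.pi_pos]
  field_simp

theorem norm_factor_ofReal_sq (a : ℕ) (z : ℂ) (x : ℝ) :
    ‖factor a z x‖ ^ 2 = (a.factorial / (2 * Real.pi)) ^ 2 *
      (((x - z.re) ^ 2 + z.im ^ 2) ^ (a + 1))⁻¹ := by
  have h := norm_invPow_sq a (starRingEnd ℂ z) x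
  simp only [invPow, norm_inv, norm_pow, Complex.conj_re, Complex.conj_im, neg_sq] at h
  rw [norm_factor, ← h, div_eq_mul_inv, mul_pow]

theorem integrable_norm_factor_sq (a : ℕ) {z : ℂ} (hz : 0 < z.im) :
    Integrable fun x : ℝ => ‖factor a z x‖ ^ 2 := by
  simp only [norm_factor_ofReal_sq]
  exact (integrable_inv_sub_sq_add_sq_pow a _ hz.ne').const_mul _

theorem integral_norm_factor_sq (a : ℕ) {z : ℂ} (hz : 0 < z.im) :
    ∫ x : ℝ, ‖factor a z x‖ ^ 2 = factorSq a z.im := by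
  simp only [norm_factor_ofReal_sq]
  rw [integral_const_mul, integral_inv_sub_sq_add_sq_pow a _ hz, factorSq]

/-- The reproducing property of the one-dimensional kernel on the kernel derivatives. -/
theorem integral_conj_factor_mul_factor_zero (a : ℕ) {z w : ℂ} (hz : 0 < z.im) (hw : 0 < w.im) :
    ∫ x : ℝ, starRingEnd ℂ (factor a z x) * factor 0 w x = starRingEnd ℂ (factor a z w) := by
  have h := integral_invPow_zero_mul_invPow a (ω := starRingEnd ℂ w) (ζ := z) (by simpa using hw) hz
  have e : ∀ x : ℝ, starRingEnd ℂ (factor a z x) * factor 0 w x =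
      (-(1 / (2 * (Real.pi : ℂ) * Complex.I)) ^ 2 * a.factorial) *
        (invPow 0 (starRingEnd ℂ w) x * invPow a z x) := by
    intro x
    have : starRingEnd ℂ (invPow a (starRingEnd ℂ z) x) = invPow a z x := by simp [invPow]
    rw [factor_ofReal, factor_ofReal, map_mul, this]
    simp only [map_mul, map_div₀, map_neg, map_one, map_ofNat, Complex.conj_ofReal, Complex.conj_I,
      map_natCast, Nat.factorial_zero, Nat.cast_one]
    ring
  simp only [e]
  rw [integral_const_mul, h, factor]
  have hpi : (Real.pi : ℂ) ≠ 0 := by exact_mod_cast Real.pi_ne_zero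
  simp only [map_mul, map_div₀, map_neg, map_one, map_ofNat, Complex.conj_ofReal, Complex.conj_I,
      map_natCast, map_pow, map_sub, Complex.conj_conj]
  field_simp

/-! ### Decay of the one-dimensional coefficients -/

/-- The pairing of the normalised kernel derivative with the kernel at `w`. -/
noncomputable def normalizedFactor (w : ℂ) (p : ℕ × UpperHalfPlane) : ℂ :=
  starRingEnd ℂ (factor p.1 p.2 w) / (√(factorSq p.1 p.2.im) : ℂ)

theorem sub_conj_ne_zero {w z : ℂ} (hw : 0 < w.im) (hz : 0 < z.im) : w - starRingEnd ℂ z ≠ 0 := by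
  intro h
  have h1 := congrArg Complex.im h
  simp at h1
  linarith

theorem add_im_le_norm_sub_conj (w z : ℂ) : w.im + z.im ≤ ‖w - starRingEnd ℂ z‖ := by
  refine le_trans (le_abs_self _) ?_
  simpa using Complex.abs_im_le_norm (w - starRingEnd ℂ z)

theorem continuous_normalizedFactor {w : ℂ} (hw : 0 < w.im) :
    Continuous (normalizedFactor w) := by
  rw [continuous_prod_of_discrete_left]
  intro a
  unfold normalizedFactor factor factorSq
  dsimp only
  have hc := UpperHalfPlane.continuous_coe
  have hi := UpperHalfPlane.continuous_im
  refine Continuous.div ?_ ?_ ?_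
  · refine Complex.continuous_conj.comp (Continuous.fun_mul continuous_const
      (Continuous.div₀ continuous_const ?_ ?_))
    · exact Continuous.fun_pow (continuous_const.sub (Complex.continuous_conj.comp hc)) _
    · exact fun z => pow_ne_zero _ (sub_conj_ne_zero hw z.im_pos)
  · refine Complex.continuous_ofReal.comp (Real.continuous_sqrt.comp (Continuous.fun_mul continuous_const
      (Continuous.div₀ continuous_const (Continuous.fun_pow hi _) fun z => (pow_pos z.im_pos _).ne')))
  · intro z
    have := Real.sqrt_pos.2 (factorSq_pos a z.im_pos)
    exact_mod_cast this.ne'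

theorem norm_normalizedFactor_sq_le (w : ℂ) (p : ℕ × UpperHalfPlane) :
    ‖normalizedFactor w p‖ ^ 2 ≤ √(p.1 + 1) *
      (p.2.im ^ (2 * p.1 + 1) / ‖w - starRingEnd ℂ (p.2 : ℂ)‖ ^ (2 * p.1 + 2)) := by
  obtain ⟨a, z⟩ := p
  have hy := z.im_pos
  have hB := bumpIntegral_pos a
  -- The Gaussian lower bound, with π weakened to 1.
  have hle : (bumpIntegral a)⁻¹ ≤ √(a + 1) := by
    rw [inv_le_comm₀ hB (Real.sqrt_pos.2 (by positivity)), ← Real.sqrt_inv]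
    refine le_trans (Real.sqrt_le_sqrt ?_) (sqrt_le_bumpIntegral a)
    rw [inv_eq_one_div]
    gcongr
    linarith [Real.pi_gt_three]
  have heq : ‖normalizedFactor w (a, z)‖ ^ 2 = (bumpIntegral a)⁻¹ *
      (z.im ^ (2 * a + 1) / ‖w - starRingEnd ℂ (z : ℂ)‖ ^ (2 * a + 2)) := by
    have hf := Nat.factorial_pos a
    rw [normalizedFactor, norm_div, div_pow, Complex.norm_real, Real.norm_eq_abs, sq_abs,
      Real.sq_sqrt (factorSq_pos a hy).le, RCLike.norm_conj, norm_factor, factorSq, div_pow,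
      ← pow_mul, show (a + 1) * 2 = 2 * a + 2 by ring]
    field_simp
  rw [heq]
  gcongr

/-- The first two binomial terms. The linear one gains a factor of order a in the next bound, which
beats the √(a+1) from the normalisation. -/
theorem succ_mul_pow_mul_le {y v : ℝ} (hy : 0 ≤ y) (hv : 0 ≤ v) (m : ℕ) :
    y ^ (m + 1) + (m + 1) * y ^ m * v ≤ (y + v) ^ (m + 1) := by
  induction m with
  | zero => simp
  | succ m ih =>
    have h := mul_le_mul_of_nonneg_left ih (add_nonneg hy hv)
    have h2 : 0 ≤ ((m : ℝ) + 1) * y ^ m * v ^ 2 := by positivity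
    rw [pow_succ' (y + v) (m + 1)]
    push_cast
    refine le_trans ?_ h
    rw [show (y + v) * (y ^ (m + 1) + (m + 1) * y ^ m * v) = y ^ (m + 1 + 1) +
      (m + 1 + 1) * y ^ (m + 1) * v + (m + 1) * y ^ m * v ^ 2 by ring]
    linarith

theorem norm_normalizedFactor_sq_le_order {w : ℂ} (hw : 0 < w.im) (p : ℕ × UpperHalfPlane) :
    ‖normalizedFactor w p‖ ^ 2 ≤ 1 / (w.im * √(p.1 + 1)) := by
  refine (norm_normalizedFactor_sq_le w p).trans ?_
  obtain ⟨a, z⟩ := p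
  have hy := z.im_pos
  have h1 := add_im_le_norm_sub_conj w z
  have hh : 0 < ‖w - starRingEnd ℂ (z : ℂ)‖ := by
    have : (z : ℂ).im = z.im := rfl
    linarith
  have h2 : z.im ^ (2 * a + 1) / ‖w - starRingEnd ℂ (z : ℂ)‖ ^ (2 * a + 2) ≤
      1 / (w.im * (a + 1)) := by
    rw [div_le_div_iff₀ (by positivity) (by positivity), one_mul]
    have h3 := succ_mul_pow_mul_le hy.le hw.le (2 * a + 1)
    have h4 : (z.im + w.im) ^ (2 * a + 1 + 1) ≤ ‖w - starRingEnd ℂ (z : ℂ)‖ ^ (2 * a + 2) := by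
      refine pow_le_pow_left₀ (by positivity) ?_ _
      have : (z : ℂ).im = z.im := rfl
      linarith
    have h5 : 0 ≤ z.im ^ (2 * a + 1 + 1) := by positivity
    have h6 : 0 ≤ z.im ^ (2 * a + 1) * w.im * (a + 1) := by positivity
    push_cast at h3
    nlinarith
  refine (mul_le_mul_of_nonneg_left h2 (Real.sqrt_nonneg _)).trans_eq ?_
  have ha : (0 : ℝ) < a + 1 := by positivity
  have hs := Real.sqrt_pos.2 ha
  have hss := Real.mul_self_sqrt ha.le
  field_simp
  linear_combination hss

theorem norm_normalizedFactor_sq_le_dist {w : ℂ} (hw : 0 < w.im) (p : ℕ × UpperHalfPlane) :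
    ‖normalizedFactor w p‖ ^ 2 ≤ √(p.1 + 1) / ‖w - starRingEnd ℂ (p.2 : ℂ)‖ := by
  refine (norm_normalizedFactor_sq_le w p).trans ?_
  obtain ⟨a, z⟩ := p
  have hy := z.im_pos
  have h1 : w.im + z.im ≤ _ := add_im_le_norm_sub_conj w z
  simp only
  set h := ‖w - starRingEnd ℂ (z : ℂ)‖
  have hh : 0 < h := by linarith
  rw [div_eq_mul_inv (√_)]
  refine mul_le_mul_of_nonneg_left ?_ (Real.sqrt_nonneg _)
  rw [div_le_iff₀ (by positivity), show 2 * a + 2 = (2 * a + 1) + 1 by ring, pow_succ h,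
    inv_mul_eq_div, mul_div_cancel_right₀ _ hh.ne']
  exact pow_le_pow_left₀ hy.le (by linarith) _

theorem norm_normalizedFactor_sq_le_im {w : ℂ} (hw : 0 < w.im) (p : ℕ × UpperHalfPlane) :
    ‖normalizedFactor w p‖ ^ 2 ≤ √(p.1 + 1) * (p.2.im / w.im ^ 2) := by
  refine (norm_normalizedFactor_sq_le w p).trans ?_
  obtain ⟨a, z⟩ := p
  have hy := z.im_pos
  have h1 : w.im + z.im ≤ _ := add_im_le_norm_sub_conj w z
  simp only
  set h := ‖w - starRingEnd ℂ (z : ℂ)‖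
  have hh : 0 < h := by linarith
  refine mul_le_mul_of_nonneg_left ?_ (Real.sqrt_nonneg _)
  rw [div_le_div_iff₀ (by positivity) (by positivity)]
  calc z.im ^ (2 * a + 1) * w.im ^ 2 = z.im * (z.im ^ (2 * a) * w.im ^ 2) := by ring
    _ ≤ z.im * (h ^ (2 * a) * h ^ 2) := by gcongr <;> linarith
    _ = _ := by ring

theorem tendsto_normalizedFactor {w : ℂ} (hw : 0 < w.im) :
    Tendsto (normalizedFactor w) (cocompact (ℕ × UpperHalfPlane)) (𝓝 0) := by
  rw [Metric.tendsto_nhds]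
  intro ε hε
  -- The order bound confines a modulus ≥ ε to orders at most A. With a ≤ A, the other two bounds
  -- then force Im z ≥ δ and |w - conj z| ≤ R.
  obtain ⟨A, hA⟩ := exists_nat_gt ((1 / (w.im * ε ^ 2)) ^ 2)
  set δ : ℝ := ε ^ 2 * w.im ^ 2 / √(A + 1) with hδ
  set R : ℝ := √(A + 1) / ε ^ 2 with hR
  have hs : 0 < √((A : ℝ) + 1) := Real.sqrt_pos.2 (by positivity)
  set S : Set ℂ := {z | δ ≤ z.im} ∩ {z | ‖w - starRingEnd ℂ z‖ ≤ R} with hS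
  have hScomp : IsCompact S := by
    refine Metric.isCompact_of_isClosed_isBounded ?_ ?_
    · exact (isClosed_le continuous_const Complex.continuous_im).inter
        (isClosed_le (by fun_prop) continuous_const)
    · refine (Metric.isBounded_closedBall (x := (0 : ℂ)) (r := R + ‖w‖)).subset fun z hz => ?_
      rw [mem_closedBall_zero_iff]
      have h1 : ‖w - starRingEnd ℂ z‖ ≤ R := hz.2
      have h2 := norm_sub_norm_le (starRingEnd ℂ z) w
      rw [RCLike.norm_conj, norm_sub_rev] at h2
      linarith
  -- Because δ > 0, the compact set S lies inside the open half-plane, so it is still compact there.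
  have hT : IsCompact (((↑) : UpperHalfPlane → ℂ) ⁻¹' S) := by
    rw [UpperHalfPlane.isOpenEmbedding_coe.isEmbedding.isCompact_iff, Set.image_preimage_eq_of_subset]
    · exact hScomp
    · intro z hz
      have hz1 : δ ≤ z.im := hz.1
      have : 0 < δ := by positivity
      exact ⟨⟨z, this.trans_le hz1⟩, rfl⟩
  rw [Filter.Eventually, mem_cocompact]
  refine ⟨Set.Iic A ×ˢ (((↑) : UpperHalfPlane → ℂ) ⁻¹' S),
    ((Set.finite_Iic A).isCompact).prod hT, fun p hp => ?_⟩
  show dist _ _ < ε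
  rw [dist_zero_right]
  by_contra! hlt
  refine hp ?_
  have hsq : ε ^ 2 ≤ ‖normalizedFactor w p‖ ^ 2 := pow_le_pow_left₀ hε.le hlt 2
  have ha : p.1 ≤ A := by
    by_contra! hgt
    have h1 := hsq.trans (norm_normalizedFactor_sq_le_order hw p)
    have hsp : 0 < √((p.1 : ℝ) + 1) := Real.sqrt_pos.2 (by positivity)
    have h2 : √((p.1 : ℝ) + 1) ≤ 1 / (w.im * ε ^ 2) := by
      rw [le_div_iff₀ (by positivity)] at h1 ⊢
      linarith
    rw [Real.sqrt_le_left (by positivity)] at h2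
    have : (A : ℝ) < p.1 := by exact_mod_cast hgt
    linarith
  have hsA : √((p.1 : ℝ) + 1) ≤ √((A : ℝ) + 1) := Real.sqrt_le_sqrt (by gcongr)
  have hy := p.2.im_pos
  have h1 : w.im + p.2.im ≤ _ := add_im_le_norm_sub_conj w p.2
  refine ⟨ha, ?_, ?_⟩
  · show δ ≤ p.2.im
    have h2 := hsq.trans (norm_normalizedFactor_sq_le_im hw p)
    have h3 : ε ^ 2 ≤ √((A : ℝ) + 1) * (p.2.im / w.im ^ 2) :=
      h2.trans (mul_le_mul_of_nonneg_right hsA (by positivity))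
    rw [hδ, div_le_iff₀ hs]
    rw [← mul_div_assoc, le_div_iff₀ (by positivity)] at h3
    linarith
  · show ‖w - starRingEnd ℂ (p.2 : ℂ)‖ ≤ R
    have hh : 0 < ‖w - starRingEnd ℂ (p.2 : ℂ)‖ := by linarith
    have h2 := hsq.trans (norm_normalizedFactor_sq_le_dist hw p)
    rw [le_div_iff₀ hh] at h2
    rw [hR, le_div_iff₀ (by positivity)]
    linarith

theorem norm_normalizedFactor_le {w : ℂ} (hw : 0 < w.im) (p : ℕ × UpperHalfPlane) :
    ‖normalizedFactor w p‖ ≤ √(1 / w.im) := by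
  refine Real.le_sqrt_of_sq_le ((norm_normalizedFactor_sq_le_order hw p).trans ?_)
  refine one_div_le_one_div_of_le hw (le_mul_of_one_le_right hw.le ?_)
  rw [Real.one_le_sqrt]
  linarith [Nat.cast_nonneg (α := ℝ) p.1]

/-- Along the coproduct filter it suffices to treat one escaping coordinate at a time: its factor
tends to 0 while the others stay bounded. For cocompact filters the coproduct is the cocompact
filter of the product. -/
theorem tendsto_prod_coprodᵢ {ι : Type*} [Fintype ι] {X : ι → Type*} {l : ∀ i, Filter (X i)}
    {s : ∀ i, X i → ℂ} {C : ι → ℝ} (hC : ∀ i x, ‖s i x‖ ≤ C i)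
    (hs : ∀ i, Tendsto (s i) (l i) (𝓝 0)) :
    Tendsto (fun p : ∀ i, X i => ∏ i, s i (p i)) (Filter.coprodᵢ l) (𝓝 0) := by
  classical
  rw [Filter.coprodᵢ, tendsto_iSup]
  intro i
  have h1 : Tendsto (fun p : ∀ i, X i => s i (p i)) (comap (Function.eval i) (l i)) (𝓝 0) :=
    (hs i).comp tendsto_comap
  have h2 := h1.norm.mul_const (∏ k ∈ Finset.univ.erase i, C k)
  rw [norm_zero, zero_mul] at h2
  refine squeeze_zero_norm (fun p => ?_) h2
  rw [← Finset.mul_prod_erase _ _ (Finset.mem_univ i), norm_mul, norm_prod]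
  exact mul_le_mul_of_nonneg_left (Finset.prod_le_prod (fun _ _ => norm_nonneg _)
    fun k _ => hC k _) (norm_nonneg _)

/-! ### Kernel derivatives in several variables: norms, boundary values and inner products -/

/-- The restriction of `φ_{α,z}` to `ℝⁿ`. -/
noncomputable def kernel (α : Fin n → ℕ) (z : Fin n → ℂ) (x : Fin n → ℝ) : ℂ :=
  ∏ j, factor (α j) (z j) (x j)

/-- The squared `L²(ℝⁿ)` norm of `kernel α z`. -/
noncomputable def kernelSq (α : Fin n → ℕ) (z : Fin n → ℂ) : ℝ := ∏ j, factorSq (α j) (z j).im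

/-- The point `z + iη`. -/
noncomputable def shiftIm (z : Fin n → ℂ) (η : Fin n → ℝ) : Fin n → ℂ :=
  fun j => z j + Complex.I * (η j : ℂ)

theorem shiftIm_mem_tube {z : Fin n → ℂ} (hz : z ∈ tube n) {η : Fin n → ℝ} (hη : η ∈ octant n) :
    shiftIm z η ∈ tube n := by
  intro j
  have := hz j
  have := hη j
  simp only [shiftIm, Complex.add_im, Complex.mul_im, Complex.I_re, Complex.I_im,
    Complex.ofReal_re, Complex.ofReal_im]
  linarith

theorem phi_toC (α : Fin n → ℕ) {z : Fin n → ℂ} (hz : z ∈ tube n) (x : Fin n → ℝ)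
    {η : Fin n → ℝ} (hη : η ∈ octant n) : phi α z (toC x η) = kernel α (shiftIm z η) x := by
  rw [phi_eq α z _ hz (toC_mem_tube x hη)]
  exact Finset.prod_congr rfl fun j _ => factor_add_I_mul (α j) (z j) (x j) (η j)

theorem continuous_kernel (α : Fin n → ℕ) {z : Fin n → ℂ} (hz : z ∈ tube n) :
    Continuous (kernel α z) :=
  continuous_finsetProd _ fun j _ =>
    (continuous_factor_ofReal (α j) (hz j)).comp (continuous_apply j)

theorem kernelSq_pos (α : Fin n → ℕ) {z : Fin n → ℂ} (hz : z ∈ tube n) : 0 < kernelSq α z :=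
  Finset.prod_pos fun j _ => factorSq_pos _ (hz j)

theorem integrable_norm_kernel_sq (α : Fin n → ℕ) {z : Fin n → ℂ} (hz : z ∈ tube n) :
    Integrable fun x => ‖kernel α z x‖ ^ 2 := by
  simp only [kernel, norm_prod, ← Finset.prod_pow]
  exact Integrable.fintype_prod (f := fun j (x : ℝ) => ‖factor (α j) (z j) x‖ ^ 2)
    fun j => integrable_norm_factor_sq (α j) (hz j)

theorem integral_norm_kernel_sq (α : Fin n → ℕ) {z : Fin n → ℂ} (hz : z ∈ tube n) :
    ∫ x, ‖kernel α z x‖ ^ 2 = kernelSq α z := by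
  simp only [kernel, norm_prod, ← Finset.prod_pow]
  rw [integral_fintype_prod_volume_eq_prod (fun j (x : ℝ) => ‖factor (α j) (z j) x‖ ^ 2)]
  exact Finset.prod_congr rfl fun j _ => integral_norm_factor_sq (α j) (hz j)

theorem memLp_kernel (α : Fin n → ℕ) {z : Fin n → ℂ} (hz : z ∈ tube n) :
    MemLp (kernel α z) 2 volume :=
  (memLp_two_iff_integrable_sq_norm (continuous_kernel α hz).aestronglyMeasurable).2
    (integrable_norm_kernel_sq α hz)

theorem lintegral_kernel_sq (α : Fin n → ℕ) {z : Fin n → ℂ} (hz : z ∈ tube n) :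
    ∫⁻ x, ‖kernel α z x‖ₑ ^ 2 = ENNReal.ofReal (kernelSq α z) := by
  rw [← integral_norm_kernel_sq α hz, ofReal_integral_eq_lintegral_ofReal
    (integrable_norm_kernel_sq α hz) (Eventually.of_forall fun x => by positivity)]
  refine lintegral_congr fun x => ?_
  rw [ENNReal.ofReal_pow (norm_nonneg _), ofReal_norm]

theorem factorSq_antitone (a : ℕ) {y y' : ℝ} (hy : 0 < y) (h : y ≤ y') :
    factorSq a y' ≤ factorSq a y := by
  have := bumpIntegral_pos a
  unfold factorSq
  gcongr

theorem continuousAt_factorSq (a : ℕ) {y : ℝ} (hy : 0 < y) : ContinuousAt (factorSq a) y := by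
  unfold factorSq
  exact continuousAt_const.mul (continuousAt_const.div₀ (continuousAt_id.pow _)
    (pow_pos hy _).ne')

/-- Going up by η only increases the imaginary parts of z, hence decreases the norm; the supremum is
the limit as η → 0. -/
theorem hardySq_phi (α : Fin n → ℕ) {z : Fin n → ℂ} (hz : z ∈ tube n) :
    hardySq (phi α z) = ENNReal.ofReal (kernelSq α z) := by
  have hslice : ∀ η ∈ octant n, ∫⁻ x, ‖phi α z (toC x η)‖ₑ ^ 2 =
      ENNReal.ofReal (kernelSq α (shiftIm z η)) := by
    intro η hη
    rw [← lintegral_kernel_sq α (shiftIm_mem_tube hz hη)]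
    exact lintegral_congr fun x => by rw [phi_toC α hz x hη]
  have him : ∀ (η : Fin n → ℝ) j, (shiftIm z η j).im = (z j).im + η j := by
    intro η j; simp [shiftIm]
  refine le_antisymm (iSup₂_le fun η hη => ?_) ?_
  · rw [hslice η hη]
    refine ENNReal.ofReal_le_ofReal (Finset.prod_le_prod (fun j _ => ?_) fun j _ => ?_)
    · exact (factorSq_pos _ (shiftIm_mem_tube hz hη j)).le
    · rw [him]
      exact factorSq_antitone _ (hz j) (by linarith [hη j])
  · have ht : Tendsto (fun η : Fin n → ℝ => ENNReal.ofReal (kernelSq α (shiftIm z η)))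
        (𝓝[octant n] 0) (𝓝 (ENNReal.ofReal (kernelSq α z))) := by
      refine ENNReal.tendsto_ofReal (tendsto_finsetProd _ fun j _ => ?_)
      have h1 : Tendsto (fun η : Fin n → ℝ => (shiftIm z η j).im) (𝓝[octant n] 0)
          (𝓝 (z j).im) := by
        simp only [him]
        exact (Continuous.tendsto' (by fun_prop) _ _ (by simp)).mono_left nhdsWithin_le_nhds
      exact (continuousAt_factorSq (α j) (hz j)).tendsto.comp h1
    refine le_of_tendsto ht ?_
    filter_upwards [self_mem_nhdsWithin] with η hη
    rw [← hslice η hη]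
    exact MemHardy.lintegral_slice_le hη

theorem memHardy_phi (α : Fin n → ℕ) {z : Fin n → ℂ} (hz : z ∈ tube n) : MemHardy (phi α z) := by
  refine ⟨?_, by rw [hardySq_phi α hz]; exact ENNReal.ofReal_lt_top⟩
  have h : DifferentiableOn ℂ (phiClosed α z) (tube n) := by
    unfold phiClosed
    intro w hw
    refine (HasFDerivWithinAt.finsetProd (𝕜 := ℂ) (u := Finset.univ) (s := tube n) (x := w)
      (g := fun (j : Fin n) (w : Fin n → ℂ) => -1 / (2 * (Real.pi : ℂ) * Complex.I) *
        ((α j).factorial / (w j - starRingEnd ℂ (z j)) ^ (α j + 1)))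
      fun j _ => DifferentiableWithinAt.hasFDerivWithinAt ?_).differentiableWithinAt
    have hne : (w j - starRingEnd ℂ (z j)) ^ (α j + 1) ≠ 0 :=
      pow_ne_zero _ (sub_conj_ne_zero (hw j) (hz j))
    simp only [div_eq_mul_inv]
    fun_prop (disch := assumption)
  exact h.congr fun w hw => phi_eq α z w hz hw

theorem hardyNorm_phi (α : Fin n → ℕ) {z : Fin n → ℂ} (hz : z ∈ tube n) :
    hardyNorm (phi α z) = √(kernelSq α z) := by
  rw [hardyNorm, hardySq_phi α hz, ENNReal.toReal_ofReal (kernelSq_pos α hz).le]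

theorem norm_factor_shift_le (a : ℕ) {z : ℂ} (hz : 0 < z.im) {η : ℝ} (hη : 0 ≤ η) (x : ℝ) :
    ‖factor a (z + Complex.I * η) x‖ ≤ ‖factor a z x‖ := by
  refine le_of_sq_le_sq ?_ (norm_nonneg _)
  rw [norm_factor_ofReal_sq, norm_factor_ofReal_sq]
  have him : (z + Complex.I * η).im = z.im + η := by simp
  have hre : (z + Complex.I * η).re = z.re := by simp
  rw [him, hre]
  gcongr
  linarith

theorem norm_kernel_shift_le (α : Fin n → ℕ) {z : Fin n → ℂ} (hz : z ∈ tube n) {η : Fin n → ℝ}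
    (hη : η ∈ octant n) (x : Fin n → ℝ) : ‖kernel α (shiftIm z η) x‖ ≤ ‖kernel α z x‖ := by
  rw [kernel, kernel, norm_prod, norm_prod]
  exact Finset.prod_le_prod (fun _ _ => norm_nonneg _) fun j _ =>
    norm_factor_shift_le (α j) (hz j) (hη j).le (x j)

theorem tendsto_kernel_shift (α : Fin n → ℕ) {z : Fin n → ℂ} (hz : z ∈ tube n) (x : Fin n → ℝ) :
    Tendsto (fun η => kernel α (shiftIm z η) x) (𝓝[octant n] 0) (𝓝 (kernel α z x)) := by
  refine tendsto_finsetProd _ fun j _ => ?_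
  have hc : ContinuousAt (fun η : Fin n → ℝ => factor (α j) (z j) (x j + Complex.I * (η j : ℂ)))
      0 := by
    unfold factor
    refine continuousAt_const.mul (ContinuousAt.div₀ continuousAt_const (Continuous.continuousAt ?_) ?_)
    · exact ((continuous_const.add (continuous_const.mul (Complex.continuous_ofReal.comp
        (continuous_apply j)))).sub continuous_const).pow _
    refine pow_ne_zero _ ?_
    simpa [Complex.conj_im] using ofReal_sub_ne_zero (ζ := starRingEnd ℂ (z j))
      (by simpa using (hz j).ne') (x j)
  have h := hc.tendsto
  simp only [factor_add_I_mul] at h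
  simp only [Pi.zero_apply, Complex.ofReal_zero, mul_zero, add_zero] at h
  exact h.mono_left nhdsWithin_le_nhds

theorem isBoundaryValue_phi (α : Fin n → ℕ) {z : Fin n → ℂ} (hz : z ∈ tube n) :
    IsBoundaryValue (phi α z) (kernel α z) := by
  refine ⟨memLp_kernel α hz, ?_⟩
  have hb : Tendsto (fun η => ∫⁻ x, ‖phi α z (toC x η) - kernel α z x‖ₑ ^ 2)
      (𝓝[octant n] 0) (𝓝 (∫⁻ _ : Fin n → ℝ, 0)) := by
    -- Raising the parameter decreases the kernel pointwise, so the difference is at most twice the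
    -- boundary kernel; squaring gives the constant 4.
    refine tendsto_lintegral_filter_of_dominated_convergence
      (fun x => 4 * ‖kernel α z x‖ₑ ^ 2) ?_ ?_ ?_ ?_
    · filter_upwards [self_mem_nhdsWithin] with η hη
      exact ((((memHardy_phi α hz).continuous_slice hη).sub
        (continuous_kernel α hz)).enorm.measurable.pow_const 2)
    · filter_upwards [self_mem_nhdsWithin] with η hη
      refine Eventually.of_forall fun x => ?_
      have h1 : ‖phi α z (toC x η)‖ₑ ≤ ‖kernel α z x‖ₑ := by
        rw [phi_toC α hz x hη]
        exact enorm_le_iff_norm_le.2 (norm_kernel_shift_le α hz hη x)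
      calc ‖phi α z (toC x η) - kernel α z x‖ₑ ^ 2
          ≤ (‖kernel α z x‖ₑ + ‖kernel α z x‖ₑ) ^ 2 := by
            gcongr
            exact enorm_sub_le.trans (add_le_add_left h1 _)
        _ = 4 * ‖kernel α z x‖ₑ ^ 2 := by ring
    · rw [lintegral_const_mul _ ((continuous_kernel α hz).enorm.measurable.pow_const 2),
        lintegral_kernel_sq α hz]
      exact ENNReal.mul_ne_top (by norm_num) ENNReal.ofReal_ne_top
    · refine Eventually.of_forall fun x => ?_
      have h1 : Tendsto (fun η => phi α z (toC x η)) (𝓝[octant n] 0) (𝓝 (kernel α z x)) := by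
        refine (tendsto_kernel_shift α hz x).congr' ?_
        filter_upwards [self_mem_nhdsWithin] with η hη
        rw [phi_toC α hz x hη]
      have h2 := ((ENNReal.continuous_pow 2).tendsto _).comp (h1.sub_const (kernel α z x)).enorm
      simpa [Function.comp_def] using h2
  rw [lintegral_zero] at hb
  have h3 := (ENNReal.continuous_rpow_const (y := 1 / 2)).tendsto 0 |>.comp hb
  rw [ENNReal.zero_rpow_of_pos (by norm_num)] at h3
  refine h3.congr fun η => ?_
  rw [eLpNorm_eq_lintegral_rpow_enorm_toReal (by norm_num) (by norm_num)]
  simp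

theorem IsBoundaryValue.div_const {F : (Fin n → ℂ) → ℂ} {f : (Fin n → ℝ) → ℂ}
    (h : IsBoundaryValue F f) (c : ℂ) : IsBoundaryValue (fun w => F w / c) fun x => f x / c := by
  have e : ∀ g : (Fin n → ℝ) → ℂ, (fun x => g x / c) = c⁻¹ • g := by
    intro g; funext x; simp [div_eq_inv_mul]
  refine ⟨by rw [e]; exact h.memLp.const_smul _, ?_⟩
  have h1 := ENNReal.Tendsto.const_mul (a := ‖c⁻¹‖ₑ) h.tendsto (Or.inr enorm_ne_top)
  rw [mul_zero] at h1
  refine h1.congr fun η => ?_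
  rw [← eLpNorm_const_smul, ← e]
  simp only [sub_div]

theorem MemHardy.div_const {F : (Fin n → ℂ) → ℂ} (hF : MemHardy F) (c : ℂ) :
    MemHardy fun w => F w / c := by
  refine ⟨by simpa only [div_eq_mul_inv] using hF.holomorphic.mul_const c⁻¹, ?_⟩
  have : hardySq (fun w => F w / c) ≤ ‖c⁻¹‖ₑ ^ 2 * hardySq F := by
    refine iSup₂_le fun y hy => ?_
    simp only [div_eq_inv_mul, enorm_mul, mul_pow]
    rw [lintegral_const_mul _ ((hF.continuous_slice hy).enorm.measurable.pow_const 2)]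
    gcongr
    exact MemHardy.lintegral_slice_le hy
  exact this.trans_lt (ENNReal.mul_lt_top (ENNReal.pow_lt_top enorm_lt_top) hF.bounded)

theorem hardyInner_eq {F G : (Fin n → ℂ) → ℂ} {f g : (Fin n → ℝ) → ℂ} (hF : MemHardy F)
    (hG : MemHardy G) (hf : IsBoundaryValue F f) (hg : IsBoundaryValue G g) :
    hardyInner F G = ∫ ξ, f ξ * starRingEnd ℂ (g ξ) := by
  refine integral_congr_ae ?_
  filter_upwards [IsBoundaryValue.ae_eq hF hF.isBoundaryValue_boundaryValue hf,
    IsBoundaryValue.ae_eq hG hG.isBoundaryValue_boundaryValue hg] with x h1 h2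
  rw [h1, h2]

theorem hardyInner_psi {F : (Fin n → ℂ) → ℂ} (hF : MemHardy F) (α : Fin n → ℕ) {z : Fin n → ℂ}
    (hz : z ∈ tube n) : hardyInner F (psi α z) =
      hardyInner F (phi α z) / (hardyNorm (phi α z) : ℂ) := by
  have hf := hF.isBoundaryValue_boundaryValue
  have hp := memHardy_phi α hz
  rw [hardyInner_eq hF hp hf (isBoundaryValue_phi α hz)]
  have h := hardyInner_eq hF (hp.div_const (hardyNorm (phi α z) : ℂ)) hf
    ((isBoundaryValue_phi α hz).div_const (hardyNorm (phi α z) : ℂ))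
  rw [← integral_div]
  refine h.trans (integral_congr_ae (Eventually.of_forall fun x => ?_))
  simp only [map_div₀, Complex.conj_ofReal]
  ring

/-- `kernel α z` as an element of `L²(ℝⁿ)`. -/
noncomputable def kernelLp (α : Fin n → ℕ) {z : Fin n → ℂ} (hz : z ∈ tube n) :
    Lp ℂ 2 (volume : Measure (Fin n → ℝ)) := (memLp_kernel α hz).toLp _

theorem norm_kernelLp (α : Fin n → ℕ) {z : Fin n → ℂ} (hz : z ∈ tube n) :
    ‖kernelLp α hz‖ = √(kernelSq α z) := by
  rw [← Real.sqrt_sq (norm_nonneg (kernelLp α hz)), kernelLp, norm_sq_toLp,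
    integral_norm_kernel_sq α hz]

theorem inner_kernelLp_zero (α : Fin n → ℕ) {z w : Fin n → ℂ} (hz : z ∈ tube n)
    (hw : w ∈ tube n) : inner ℂ (kernelLp α hz) (kernelLp 0 hw) =
      ∏ j, starRingEnd ℂ (factor (α j) (z j) (w j)) := by
  rw [kernelLp, kernelLp, inner_toLp]
  simp only [kernel, map_prod, ← Finset.prod_mul_distrib, Pi.zero_apply]
  rw [integral_fintype_prod_volume_eq_prod
    (fun j (x : ℝ) => starRingEnd ℂ (factor (α j) (z j) x) * factor 0 (w j) x)]
  exact Finset.prod_congr rfl fun j _ =>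
    integral_conj_factor_mul_factor_zero (α j) (hz j) (hw j)

theorem hardyInner_phi {F : (Fin n → ℂ) → ℂ} (hF : MemHardy F) (α : Fin n → ℕ) {z : Fin n → ℂ}
    (hz : z ∈ tube n) : hardyInner F (phi α z) =
      inner ℂ (kernelLp α hz) (hF.isBoundaryValue_boundaryValue.memLp.toLp _) := by
  rw [hardyInner_eq hF (memHardy_phi α hz) hF.isBoundaryValue_boundaryValue
    (isBoundaryValue_phi α hz), kernelLp, inner_toLp]
  simp only [mul_comm]

/-! ### Orthogonality to the kernels passes to their derivatives -/

theorem add_single_mem_tube {z : Fin n → ℂ} (hz : z ∈ tube n) (j : Fin n) (t : ℝ) :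
    z + Pi.single j (t : ℂ) ∈ tube n := by
  intro k
  by_cases h : k = j
  · subst h; simpa using hz k
  · simpa [h] using hz k

theorem hasDerivAt_factor (a : ℕ) {z : ℂ} (hz : 0 < z.im) (x t : ℝ) :
    HasDerivAt (fun t : ℝ => factor a (z + t) x) (factor (a + 1) (z + t) x) t := by
  have hne : (x : ℂ) - starRingEnd ℂ z - t ≠ 0 := by
    have := ofReal_sub_ne_zero (ζ := starRingEnd ℂ z) (by simpa using hz.ne') (x - t)
    push_cast at this
    convert this using 1
    ring
  have h0 : HasDerivAt (fun t : ℝ => (x : ℂ) - starRingEnd ℂ z - t) (-1) t := by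
    simpa using (Complex.ofRealCLM.hasDerivAt (x := t)).const_sub ((x : ℂ) - starRingEnd ℂ z)
  have h1 := (((h0.pow (a + 1)).inv (pow_ne_zero _ hne)).const_mul
    (a.factorial : ℂ)).const_mul (-1 / (2 * (Real.pi : ℂ) * Complex.I))
  have e : ∀ b (t : ℝ), factor b (z + t) x = -1 / (2 * (Real.pi : ℂ) * Complex.I) *
      (b.factorial * ((((x : ℂ) - starRingEnd ℂ z - t) ^ (b + 1))⁻¹)) := by
    intro b t
    simp [factor, div_eq_mul_inv, sub_sub]
  simp only [e]
  refine h1.congr_deriv ?_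
  rw [Nat.factorial_succ]
  push_cast
  simp only [Pi.pow_apply]
  field_simp
  ring

/-- The distance |x - conj z| is at least Im z ≥ 2|t|, so the translation at most halves it. This
provides the dominating function for differentiation under the integral. -/
theorem norm_factor_add_le (a : ℕ) {z : ℂ} (hz : 0 < z.im) (x : ℝ) {t : ℝ} (ht : |t| ≤ z.im / 2) :
    ‖factor a (z + t) x‖ ≤ 2 ^ (a + 1) * ‖factor a z x‖ := by
  have h1 : z.im ≤ ‖(x : ℂ) - starRingEnd ℂ z‖ := by
    simpa using add_im_le_norm_sub_conj x z
  have h2 : ‖(x : ℂ) - starRingEnd ℂ z‖ / 2 ≤ ‖(x : ℂ) - starRingEnd ℂ (z + t)‖ := by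
    have := norm_sub_norm_le ((x : ℂ) - starRingEnd ℂ z) t
    rw [Complex.norm_real, Real.norm_eq_abs] at this
    rw [map_add, Complex.conj_ofReal, ← sub_sub]
    linarith
  have h3 : 0 < ‖(x : ℂ) - starRingEnd ℂ z‖ := hz.trans_le h1
  rw [norm_factor, norm_factor]
  calc (a.factorial : ℝ) / (2 * Real.pi) / ‖(x : ℂ) - starRingEnd ℂ (z + t)‖ ^ (a + 1)
      ≤ a.factorial / (2 * Real.pi) / (‖(x : ℂ) - starRingEnd ℂ z‖ / 2) ^ (a + 1) := by gcongr
    _ = _ := by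
      rw [div_pow]
      field_simp

/-- The coordinate derivative of `kernel α`, as a function of a real translation. -/
theorem hasDerivAt_kernel (α : Fin n → ℕ) {z : Fin n → ℂ} (hz : z ∈ tube n) (j : Fin n)
    (x : Fin n → ℝ) (t : ℝ) :
    HasDerivAt (fun t : ℝ => kernel α (z + Pi.single j (t : ℂ)) x)
      (kernel (Function.update α j (α j + 1)) (z + Pi.single j (t : ℂ)) x) t := by
  have e : ∀ (β : Fin n → ℕ) (t : ℝ), (∀ k ≠ j, β k = α k) →
      kernel β (z + Pi.single j (t : ℂ)) x = factor (β j) (z j + t) (x j) *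
        ∏ k ∈ Finset.univ.erase j, factor (α k) (z k) (x k) := by
    intro β t hβ
    rw [kernel, ← Finset.mul_prod_erase _ _ (Finset.mem_univ j)]
    congr 1
    · simp
    · refine Finset.prod_congr rfl fun k hk => ?_
      have hk' := (Finset.mem_erase.1 hk).1
      simp [hk', hβ k hk']
  simp only [e α _ fun _ _ => rfl]
  rw [e _ t fun k hk => by simp [hk]]
  simpa using (hasDerivAt_factor (α j) (hz j) (x j) t).mul_const _

theorem norm_kernel_add_single_le (α : Fin n → ℕ) {z : Fin n → ℂ} (hz : z ∈ tube n) (j : Fin n)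
    (x : Fin n → ℝ) {t : ℝ} (ht : |t| ≤ (z j).im / 2) :
    ‖kernel α (z + Pi.single j (t : ℂ)) x‖ ≤ 2 ^ (α j + 1) * ‖kernel α z x‖ := by
  rw [kernel, kernel, ← Finset.mul_prod_erase _ _ (Finset.mem_univ j),
    ← Finset.mul_prod_erase _ (fun j => factor (α j) (z j) (x j)) (Finset.mem_univ j),
    norm_mul, norm_mul, ← mul_assoc]
  refine mul_le_mul ?_ (le_of_eq ?_) (norm_nonneg _) (by positivity)
  · simpa using norm_factor_add_le (α j) (hz j) (x j) ht
  · congr 1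
    refine Finset.prod_congr rfl fun k hk => ?_
    simp [(Finset.mem_erase.1 hk).1]

/-- Real translations of z_j stay in the tube, so the hypothesis holds along the whole line.
Differentiating it under the integral at t = 0 raises α_j by one. -/
theorem integral_kernel_succ_eq_zero {f : (Fin n → ℝ) → ℂ} (hf : MemLp f 2 volume)
    {α : Fin n → ℕ} (j : Fin n)
    (h : ∀ z ∈ tube n, ∫ x, starRingEnd ℂ (f x) * kernel α z x = 0) {z : Fin n → ℂ}
    (hz : z ∈ tube n) :
    ∫ x, starRingEnd ℂ (f x) * kernel (Function.update α j (α j + 1)) z x = 0 := by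
  set β := Function.update α j (α j + 1) with hβ
  have hint : ∀ (γ : Fin n → ℕ) z, z ∈ tube n →
      Integrable fun x => starRingEnd ℂ (f x) * kernel γ z x :=
    fun γ z hz => hf.star.integrable_mul (memLp_kernel γ hz)
  have hy : 0 < (z j).im / 2 := half_pos (hz j)
  have hbound : ∀ᵐ x : Fin n → ℝ, ∀ t ∈ Metric.ball (0 : ℝ) ((z j).im / 2),
      ‖starRingEnd ℂ (f x) * kernel β (z + Pi.single j (t : ℂ)) x‖ ≤
        2 ^ (β j + 1) * ‖starRingEnd ℂ (f x) * kernel β z x‖ := by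
    refine Eventually.of_forall fun x t ht => ?_
    rw [norm_mul, norm_mul, mul_left_comm]
    refine mul_le_mul_of_nonneg_left (norm_kernel_add_single_le β hz j x ?_) (norm_nonneg _)
    rw [mem_ball_zero_iff, Real.norm_eq_abs] at ht
    exact ht.le
  have hderiv : ∀ᵐ x : Fin n → ℝ, ∀ t ∈ Metric.ball (0 : ℝ) ((z j).im / 2),
      HasDerivAt (fun t : ℝ => starRingEnd ℂ (f x) * kernel α (z + Pi.single j (t : ℂ)) x)
        (starRingEnd ℂ (f x) * kernel β (z + Pi.single j (t : ℂ)) x) t :=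
    Eventually.of_forall fun x t _ => (hasDerivAt_kernel α hz j x t).const_mul _
  have key := (hasDerivAt_integral_of_dominated_loc_of_deriv_le (Metric.ball_mem_nhds _ hy)
    (Eventually.of_forall fun t => (hint α _ (add_single_mem_tube hz j t)).aestronglyMeasurable)
    (hint α _ (add_single_mem_tube hz j 0))
    (hint β _ (add_single_mem_tube hz j 0)).aestronglyMeasurable
    hbound ((hint β _ hz).norm.const_mul _) hderiv).2
  simp only [h _ (add_single_mem_tube hz j _)] at key
  have := key.unique (hasDerivAt_const 0 (0 : ℂ))
  simpa using this

theorem integral_kernel_eq_zero {f : (Fin n → ℝ) → ℂ} (hf : MemLp f 2 volume)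
    (h : ∀ z ∈ tube n, ∫ x, starRingEnd ℂ (f x) * kernel 0 z x = 0) (α : Fin n → ℕ) :
    ∀ z ∈ tube n, ∫ x, starRingEnd ℂ (f x) * kernel α z x = 0 := by
  induction hN : ∑ j, α j generalizing α with
  | zero =>
    have : α = 0 := by
      funext j
      exact Finset.sum_eq_zero_iff.1 hN j (Finset.mem_univ j)
    exact this ▸ h
  | succ N ih =>
    obtain ⟨j, -, hj⟩ := Finset.exists_ne_zero_of_sum_ne_zero (hN.trans_ne N.succ_ne_zero)
    -- Since α_j ≠ 0, α arises by raising an index of total order N, to which the induction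
    -- hypothesis applies.
    have e : α = Function.update (Function.update α j (α j - 1)) j
        ((Function.update α j (α j - 1)) j + 1) := by
      simp [Nat.sub_add_cancel (Nat.one_le_iff_ne_zero.2 hj)]
    have hs : ∑ k, Function.update α j (α j - 1) k = N := by
      rw [Finset.sum_update_of_mem (Finset.mem_univ j)]
      rw [← Finset.add_sum_erase _ _ (Finset.mem_univ j)] at hN
      rw [← Finset.erase_eq]
      omega
    intro z hz
    rw [e]
    exact integral_kernel_succ_eq_zero hf j (ih _ hs) hz

/-! ### Dictionary coefficients vanish at infinity -/

/-- The indices `(α, z)` of the dictionary, coordinate by coordinate. -/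
abbrev Index (n : ℕ) := Fin n → ℕ × UpperHalfPlane

/-- The multi-index of a dictionary index. -/
def Index.order (p : Index n) : Fin n → ℕ := fun j => (p j).1

/-- The point of the tube of a dictionary index. -/
def Index.point (p : Index n) : Fin n → ℂ := fun j => ((p j).2 : ℂ)

theorem Index.point_mem_tube (p : Index n) : p.point ∈ tube n := fun j => (p j).2.im_pos

/-- The dictionary coefficient `⟨f, ψ_{α,z}⟩` (up to conjugation) of `f ∈ L²(ℝⁿ)`. -/
noncomputable def coeff (f : Lp ℂ 2 (volume : Measure (Fin n → ℝ))) (p : Index n) : ℂ :=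
  inner ℂ (kernelLp p.order p.point_mem_tube) f / (√(kernelSq p.order p.point) : ℂ)

theorem norm_coeff_le (f : Lp ℂ 2 (volume : Measure (Fin n → ℝ))) (p : Index n) :
    ‖coeff f p‖ ≤ ‖f‖ := by
  have h := Real.sqrt_pos.2 (kernelSq_pos p.order p.point_mem_tube)
  rw [coeff, norm_div, Complex.norm_real, Real.norm_of_nonneg h.le, div_le_iff₀ h, mul_comm]
  exact (norm_inner_le_norm _ _).trans_eq (by rw [norm_kernelLp])

theorem coeff_add (f g : Lp ℂ 2 (volume : Measure (Fin n → ℝ))) :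
    coeff (f + g) = fun p => coeff f p + coeff g p := by
  funext p
  rw [coeff, inner_add_right, add_div]
  rfl

theorem coeff_smul (c : ℂ) (f : Lp ℂ 2 (volume : Measure (Fin n → ℝ))) :
    coeff (c • f) = fun p => c * coeff f p := by
  funext p
  rw [coeff, inner_smul_right, mul_div_assoc]
  rfl

theorem coeff_kernelLp_zero {w : Fin n → ℂ} (hw : w ∈ tube n) :
    coeff (kernelLp 0 hw) = fun p => ∏ j, normalizedFactor (w j) (p j) := by
  funext p
  rw [coeff, inner_kernelLp_zero, kernelSq, Real.sqrt_prod _ fun j _ =>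
    (factorSq_pos _ (p.point_mem_tube j)).le]
  push_cast
  rw [← Finset.prod_div_distrib]
  rfl

/-- The functions in `L²(ℝⁿ)` whose dictionary coefficients are continuous and vanish at
infinity. -/
noncomputable def vanishingSubmodule (n : ℕ) :
    Submodule ℂ (Lp ℂ 2 (volume : Measure (Fin n → ℝ))) where
  carrier := {f | Continuous (coeff f) ∧ Tendsto (coeff f) (cocompact (Index n)) (𝓝 0)}
  zero_mem' := by
    have : coeff (0 : Lp ℂ 2 (volume : Measure (Fin n → ℝ))) = fun _ => 0 := by
      funext p; simp [coeff]
    show Continuous _ ∧ Tendsto _ _ _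
    rw [this]
    exact ⟨continuous_const, tendsto_const_nhds⟩
  add_mem' := fun {f g} hf hg => by
    show Continuous _ ∧ Tendsto _ _ _
    rw [coeff_add]
    exact ⟨hf.1.add hg.1, by simpa using hf.2.add hg.2⟩
  smul_mem' := fun c f hf => by
    show Continuous _ ∧ Tendsto _ _ _
    rw [coeff_smul]
    exact ⟨continuous_const.mul hf.1, by simpa using hf.2.const_mul c⟩

/-- By `norm_coeff_le`, L² convergence gives uniform convergence of coefficients, and uniform limits
preserve both continuity and vanishing at infinity. -/
theorem isClosed_vanishingSubmodule :
    IsClosed (vanishingSubmodule n : Set (Lp ℂ 2 (volume : Measure (Fin n → ℝ)))) := by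
  refine isClosed_of_closure_subset fun f hf => ?_
  rw [Metric.mem_closure_iff] at hf
  have happ : ∀ ε > 0, ∃ g ∈ vanishingSubmodule n, ∀ p, dist (coeff f p) (coeff g p) < ε := by
    intro ε hε
    obtain ⟨g, hg, hfg⟩ := hf ε hε
    refine ⟨g, hg, fun p => ?_⟩
    have e : coeff f p - coeff g p = coeff (f - g) p := by
      simp only [coeff, inner_sub_right, sub_div]
    rw [dist_eq_norm, e]
    exact (norm_coeff_le _ p).trans_lt (by rwa [← dist_eq_norm])
  constructor
  · refine continuous_of_uniform_approx_of_continuous fun u hu => ?_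
    obtain ⟨ε, hε, hsub⟩ := Metric.mem_uniformity_dist.1 hu
    obtain ⟨g, hg, h⟩ := happ ε hε
    exact ⟨coeff g, hg.1, fun p => hsub (h p)⟩
  · rw [Metric.tendsto_nhds]
    intro ε hε
    obtain ⟨g, hg, h⟩ := happ (ε / 2) (half_pos hε)
    filter_upwards [Metric.tendsto_nhds.1 hg.2 (ε / 2) (half_pos hε)] with p hp
    have := dist_triangle (coeff f p) (coeff g p) 0
    linarith [h p]

theorem kernelLp_zero_mem_vanishingSubmodule {w : Fin n → ℂ} (hw : w ∈ tube n) :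
    kernelLp 0 hw ∈ vanishingSubmodule n := by
  show Continuous _ ∧ Tendsto _ _ _
  rw [coeff_kernelLp_zero]
  refine ⟨continuous_finsetProd _ fun j _ =>
    (continuous_normalizedFactor (hw j)).comp (continuous_apply j), ?_⟩
  rw [← Filter.coprodᵢ_cocompact]
  exact tendsto_prod_coprodᵢ (fun j p => norm_normalizedFactor_le (hw j) p)
    fun j => tendsto_normalizedFactor (hw j)

/-- The dictionary coefficients of every `f ∈ L²(ℝⁿ)` are continuous and vanish at infinity. -/
theorem mem_vanishingSubmodule (f : Lp ℂ 2 (volume : Measure (Fin n → ℝ))) :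
    f ∈ vanishingSubmodule n := by
  set K := (Submodule.span ℂ (Set.range fun w : tube n => kernelLp 0 w.2)).topologicalClosure
    with hK
  have hKle : K ≤ vanishingSubmodule n := by
    refine Submodule.topologicalClosure_minimal _ (Submodule.span_le.2 ?_)
      isClosed_vanishingSubmodule
    rintro _ ⟨w, rfl⟩
    exact kernelLp_zero_mem_vanishingSubmodule w.2
  have : CompleteSpace K := (Submodule.isClosed_topologicalClosure _).completeSpace_coe
  -- Split f along the closed span of the Szegő kernels. The component g is handled by closedness,
  -- and h has all coefficients zero because it is orthogonal to every kernel and hence to every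
  -- kernel derivative.
  obtain ⟨g, hg, h, hh, rfl⟩ := K.exists_add_mem_mem_orthogonal f
  refine add_mem (hKle hg) ?_
  have horth : ∀ z ∈ tube n, ∫ x, starRingEnd ℂ (h x) * kernel 0 z x = 0 := by
    intro z hz
    have h1 := (K.mem_orthogonal' h).1 hh (kernelLp 0 hz)
      (Submodule.le_topologicalClosure _ (Submodule.subset_span ⟨⟨z, hz⟩, rfl⟩))
    rwa [← Lp.toLp_coeFn h (Lp.memLp h), kernelLp, inner_toLp] at h1
  have hzero : coeff h = fun _ => 0 := by
    funext p
    have h1 := integral_kernel_eq_zero (Lp.memLp h) horth p.order p.point p.point_mem_tube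
    rw [← inner_toLp (Lp.memLp h) (memLp_kernel p.order p.point_mem_tube), Lp.toLp_coeFn,
      inner_eq_zero_symm] at h1
    rw [coeff, kernelLp, h1, zero_div]
  show Continuous _ ∧ Tendsto _ _ _
  rw [hzero]
  exact ⟨continuous_const, tendsto_const_nhds⟩

/-- The dictionary index of `(α, z)`. -/
def Index.mk (α : Fin n → ℕ) {z : Fin n → ℂ} (hz : z ∈ tube n) : Index n :=
  fun j => (α j, ⟨z j, hz j⟩)

theorem norm_hardyInner_psi {F : (Fin n → ℂ) → ℂ} (hF : MemHardy F) (p : Index n) :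
    ‖hardyInner F (psi p.order p.point)‖ =
      ‖coeff (hF.isBoundaryValue_boundaryValue.memLp.toLp _) p‖ := by
  rw [hardyInner_psi hF _ p.point_mem_tube, hardyInner_phi hF _ p.point_mem_tube,
    hardyNorm_phi _ p.point_mem_tube, coeff]

end TubeHardy

/-! ### Uniform decay and attainment of the supremum -/

theorem lemma3p3 {n : ℕ} (F : (Fin n → ℂ) → ℂ) (hF : TubeHardy.MemHardy F) :
    (∃ f, TubeHardy.IsBoundaryValue F f) ∧
    (∀ (α : Fin n → ℕ), ∀ z ∈ TubeHardy.tube n,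
      TubeHardy.MemHardy (TubeHardy.phi α z) ∧ 0 < TubeHardy.hardyNorm (TubeHardy.phi α z)) ∧
    (∀ ε : ℝ, 0 < ε → ∃ N : ℕ, ∀ α : Fin n → ℕ, N ≤ ∑ j, α j → ∀ z ∈ TubeHardy.tube n,
      ‖TubeHardy.hardyInner F (TubeHardy.phi α z)‖ / TubeHardy.hardyNorm (TubeHardy.phi α z) < ε) ∧
    (∃ ψ ∈ TubeHardy.dictionary n, ∀ ψ' ∈ TubeHardy.dictionary n,
      ‖TubeHardy.hardyInner F ψ'‖ ≤ ‖TubeHardy.hardyInner F ψ‖) := by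
  open TubeHardy in
  have hpos : ∀ (α : Fin n → ℕ), ∀ z ∈ tube n, 0 < hardyNorm (phi α z) := fun α z hz => by
    rw [hardyNorm_phi α hz]
    exact Real.sqrt_pos.2 (kernelSq_pos α hz)
  obtain ⟨hcont, htend⟩ := TubeHardy.mem_vanishingSubmodule
    (hF.isBoundaryValue_boundaryValue.memLp.toLp _)
  have hnorm := TubeHardy.norm_hardyInner_psi hF
  set c := TubeHardy.coeff (hF.isBoundaryValue_boundaryValue.memLp.toLp _) with hc
  refine ⟨hF.exists_isBoundaryValue, fun α z hz => ⟨TubeHardy.memHardy_phi α hz, hpos α z hz⟩,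
    fun ε hε => ?_, ?_⟩
  · obtain ⟨K, hK, hKc⟩ := mem_cocompact.1 (Metric.tendsto_nhds.1 htend ε hε)
    have hord : Continuous fun p : TubeHardy.Index n => ∑ j, p.order j :=
      continuous_finsetSum _ fun j _ => continuous_fst.comp (continuous_apply j)
    -- Total order is continuous, hence at most N on the compact set K. From N + 1 on, the index
    -- lies outside K whatever z is.
    obtain ⟨N, hN⟩ := (hK.image hord).bddAbove
    refine ⟨N + 1, fun α hα z hz => ?_⟩
    have hnot : TubeHardy.Index.mk α hz ∉ K := fun hmem => by
      have : ∑ j, α j ≤ N := hN (Set.mem_image_of_mem _ hmem)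
      omega
    have h1 : dist (c (TubeHardy.Index.mk α hz)) 0 < ε := hKc hnot
    rw [dist_zero_right, ← hnorm] at h1
    have h2 : TubeHardy.hardyInner F (TubeHardy.psi α z) = _ := TubeHardy.hardyInner_psi hF α hz
    change ‖TubeHardy.hardyInner F (TubeHardy.psi α z)‖ < ε at h1
    rwa [h2, norm_div, Complex.norm_real, Real.norm_of_nonneg (hpos α z hz).le] at h1
  · have hmax : ∃ p, ∀ q, ‖c q‖ ≤ ‖c p‖ := by
      by_cases h0 : ∀ q, c q = 0
      · exact ⟨fun _ => (0, UpperHalfPlane.I), fun q => by simp [h0]⟩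
      · push Not at h0
        obtain ⟨q, hq⟩ := h0
        -- Off a compact set the modulus stays below its nonzero value at q, so the maximum over
        -- that compact set and q is global.
        refine hcont.norm.exists_forall_ge' q ?_
        filter_upwards [Metric.tendsto_nhds.1 htend ‖c q‖ (norm_pos_iff.2 hq)] with p hp
        rw [dist_zero_right] at hp
        exact hp.le
    obtain ⟨p, hp⟩ := hmax
    refine ⟨_, ⟨p.order, p.point, p.point_mem_tube, rfl⟩, ?_⟩
    rintro _ ⟨α, z, hz, rfl⟩
    rw [hnorm]
    exact (hnorm (TubeHardy.Index.mk α hz)).trans_le (hp _)
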